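/- Let $f$ be a meromorphic function on $\mathbb C$ of finite order (its Nevanlinna characteristic satisfies $T(r,f)=O(r^k)$ for some $k$). For $\rho\in\mathbb C$ let $n_\rho\in\mathbb Z$ be the multiplicity of $\rho$ in the divisor of $f$ (positive at zeros, negative at poles, $0$ elsewhere). Let $d$ be the convergence exponent of $f$, i.e. the least integer $d\ge 0$ with $\sum_{\rho\ne 0}|n_\rho|\,|\rho|^{-d}<\infty$, and assume $d\ge 1$ (equivalently, the divisor of $f$ is infinite). Assume that there is $\sigma_1\in\mathbb R$ with $\operatorname{Re}\rho\le\sigma_1$ whenever $n_\rho\neq0$. Fix $\sigma\in\mathbb C$. *Newton–Cramer distribution.* For $t\ge 0$ put $$K_{d,\sigma}(t)=n_\sigma\frac{t^d}{d!}+\sum_{\rho\neq\sigma}\frac{n_\rho}{(\rho-\sigma)^d}\,e^{(\rho-\sigma)t},\qquad W_\sigma(f)=e^{\sigma t}\,\frac{D^d}{Dt^d}\Big(\big(K_{d,\sigma}(t)-K_{d,\sigma}(0)\big)\mathbf 1_{[0,\infty)}(t)\Big),$$ where $D/Dt$ is the distributional derivative on $\mathbb R$; the series converges absolutely for every $t\ge0$.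 *Discrepancy polynomial.* Let $m=d-1$ and $E_m(z)=(1-z)\,e^{z+z^2/2+\cdots+z^m/m}$. For each $\tau\in\mathbb C$ (in particular for $\tau=0$ and $\tau=\sigma$) there is a polynomial $Q_{f,\tau}$ with $$f(s)=(s-\tau)^{n_\tau}\,e^{Q_{f,\tau}(s)}\prod_{\rho\ne\tau}E_m\!\Big(\frac{s-\tau}{\rho-\tau}\Big)^{n_\rho}$$ (an unconditionally convergent product, with equality as meromorphic functions). Let $g=\max(\deg Q_{f,0},\,m)$ be the genus of $f$ and $P_{f,\sigma}=-Q_{f,\sigma}'$ the discrepancy polynomial. Then $\deg P_{f,\sigma}\le g-1$ (with $P_{f,\sigma}=0$ if $g=0$), and we write $P_{f,\sigma}(s)=\sum_{j=0}^{g-1}c_j(\sigma)s^j$. *Inverse Laplace transform.* Call $(c,m_0)$, with $c\in\mathbb R$ and $m_0\in\mathbb Z_{\ge0}$, admissible for a meromorphic function $F$ if for some $0<\sigma_2<c$ and some constant $C$ the function $F$ is holomorphic on $\operatorname{Re}s>\sigma_2$ and $|F(s)|\,|s|^{-m_0}\le C|s|^{-2}$ there; then set $$\mathcal L^{-1}(F)=\frac{D^{m_0}}{Dt^{m_0}}L,\qquad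 L(t)=\frac1{2\pi}\int_{-\infty}^{\infty}\frac{F(c+iu)}{(c+iu)^{m_0}}\,e^{(c+iu)t}\,du .$$ **Theorem.** Admissible pairs for $F=f'/f$ exist, and for every admissible pair, as distributions on $\mathbb R$, $$W_\sigma(f)=\sum_{j=0}^{g-1}c_j(\sigma)\,\delta_0^{(j)}+\mathcal L^{-1}(f'/f).$$ -/

import Mathlib

open scoped Distributions LineDeriv Topology
open Filter MeasureTheory

noncomputable section

namespace PoissonNewton

/-! ### Complex distributions on the real line -/

/-- The space of complex-valued distributions on `ℝ`. -/
abbrev Distr : Type := 𝓓'((⊤ : TopologicalSpace.Opens ℝ), ℂ)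

/-- The distributional derivative `D/Dt`, characterised by `⟨DT, φ⟩ = -⟨T, φ'⟩`. -/
def distDeriv (T : Distr) : Distr := ∂_{(1 : ℝ)} T

/-- The regular distribution `φ ↦ ∫ φ(t) F(t) dt` of a locally integrable function `F`. -/
def ofFun (F : ℝ → ℂ) : Distr :=
  (TestFunction.integralAgainstBilinCLM (ContinuousLinearMap.lsmul ℝ ℝ) volume F :
    𝓓((⊤ : TopologicalSpace.Opens ℝ), ℝ) →L[ℝ] ℂ)

/-- The Dirac mass `δ₀`. -/
def dirac : Distr := Distribution.mapCLM Complex.ofRealCLM (Distribution.delta (0 : ℝ))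

/-- Multiplication of a test function by a smooth real function `g`. -/
def mulTest (g : ℝ → ℝ) (hg : ContDiff ℝ ((⊤ : ℕ∞) : WithTop ℕ∞) g) :
    𝓓((⊤ : TopologicalSpace.Opens ℝ), ℝ) →L[ℝ] 𝓓((⊤ : TopologicalSpace.Opens ℝ), ℝ) :=
  TestFunction.limitCLM ℝ
    (fun φ ↦ ⟨fun t ↦ φ t * g t, φ.contDiff.mul hg, φ.hasCompactSupport.mul_right,
      fun _ _ ↦ trivial⟩)
    (fun _ hK ↦ TestFunction.ofSupportedInCLM ℝ hK ∘L
      ContDiffMapSupportedIn.bilinLeftCLM (ContinuousLinearMap.mul ℝ ℝ) hg)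
    (fun _ _ _ ↦ by ext; rfl)

lemma mulTest_apply (g : ℝ → ℝ) (hg : ContDiff ℝ ((⊤ : ℕ∞) : WithTop ℕ∞) g)
    (φ : 𝓓((⊤ : TopologicalSpace.Opens ℝ), ℝ)) (t : ℝ) : mulTest g hg φ t = φ t * g t := rfl

lemma contDiff_cexp_mul (σ : ℂ) :
    ContDiff ℝ ((⊤ : ℕ∞) : WithTop ℕ∞) (fun t : ℝ ↦ Complex.exp (σ * t)) :=
  (contDiff_const.mul Complex.ofRealCLM.contDiff).cexp

/-- The product `e^{σt} T` of a distribution `T` with the smooth function `t ↦ e^{σt}`: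
`⟨e^{σt} T, φ⟩ = ⟨T, e^{σt} φ⟩`, where `T` is extended complex-linearly to complex test functions,
that is `⟨T, u + iv⟩ = ⟨T, u⟩ + i ⟨T, v⟩`. -/
def expMul (σ : ℂ) (T : Distr) : Distr :=
  (mulTest (fun t ↦ (Complex.exp (σ * t)).re)
      (Complex.reCLM.contDiff.comp (contDiff_cexp_mul σ))).precompCompactConvergenceCLM ℂ T +
    Complex.I • (mulTest (fun t ↦ (Complex.exp (σ * t)).im)
      (Complex.imCLM.contDiff.comp (contDiff_cexp_mul σ))).precompCompactConvergenceCLM ℂ T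

lemma expMul_apply (σ : ℂ) (T : Distr) (φ : 𝓓((⊤ : TopologicalSpace.Opens ℝ), ℝ)) :
    expMul σ T φ =
      T (mulTest (fun t ↦ (Complex.exp (σ * t)).re)
          (Complex.reCLM.contDiff.comp (contDiff_cexp_mul σ)) φ) +
        Complex.I * T (mulTest (fun t ↦ (Complex.exp (σ * t)).im)
          (Complex.imCLM.contDiff.comp (contDiff_cexp_mul σ)) φ) := rfl

/-! ### Meromorphic functions of finite order, divisor and convergence exponent -/

/-- `f` is meromorphic on `ℂ` of finite order: its Nevanlinna characteristic satisfies
`T(r, f) = O(r ^ k)` for some `k`. -/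
def IsMeromorphicOfFiniteOrder (f : ℂ → ℂ) : Prop :=
  Meromorphic f ∧
    ∃ k : ℕ, ValueDistribution.characteristic f ⊤ =O[atTop] fun r : ℝ ↦ r ^ k

/-- The multiplicity `n_ρ`: positive at zeros, negative at poles, `0` elsewhere. -/
def mult (f : ℂ → ℂ) (ρ : ℂ) : ℤ := MeromorphicOn.divisor f Set.univ ρ

/-- The least integer `k ≥ 0` such that `∑_{ρ ≠ 0} |n_ρ| |ρ|^{-k} < ∞`. -/
def convergenceExponent (f : ℂ → ℂ) : ℕ :=
  sInf {k : ℕ | Summable fun ρ : {ρ : ℂ // ρ ≠ 0} ↦ |(mult f ρ : ℝ)| / ‖(ρ : ℂ)‖ ^ k}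

/-- The divisor of `f` is contained in a left half-plane. -/
def HasLeftDivisor (f : ℂ → ℂ) : Prop := ∃ σ₁ : ℝ, ∀ ρ : ℂ, mult f ρ ≠ 0 → ρ.re ≤ σ₁

/-! ### The Newton-Cramer distribution -/

/-- The term of index `ρ ≠ σ` in the series `K_{d,σ}(t)`. -/
def kernelTerm (f : ℂ → ℂ) (d : ℕ) (σ : ℂ) (t : ℝ) (ρ : {ρ : ℂ // ρ ≠ σ}) : ℂ :=
  (mult f ρ : ℂ) / ((ρ : ℂ) - σ) ^ d * Complex.exp (((ρ : ℂ) - σ) * t)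

/-- `K_{d,σ}(t) = n_σ t^d / d! + ∑_{ρ ≠ σ} n_ρ (ρ - σ)^{-d} e^{(ρ - σ) t}`, for `t ≥ 0`. -/
def kernel (f : ℂ → ℂ) (d : ℕ) (σ : ℂ) (t : ℝ) : ℂ :=
  (mult f σ : ℂ) * (t : ℂ) ^ d / (d.factorial : ℂ) + ∑' ρ : {ρ : ℂ // ρ ≠ σ}, kernelTerm f d σ t ρ

/-- The Newton-Cramer distribution
`W_σ(f) = e^{σt} (D/Dt)^d ((K_{d,σ}(t) - K_{d,σ}(0)) 1_{ℝ₊})`, `d` the convergence exponent. -/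
def newtonCramer (f : ℂ → ℂ) (σ : ℂ) : Distr :=
  expMul σ (distDeriv^[convergenceExponent f] (ofFun (Set.indicator (Set.Ici 0) fun t ↦
    kernel f (convergenceExponent f) σ t - kernel f (convergenceExponent f) σ 0)))

/-! ### Hadamard factorization -/

/-- The Weierstrass factor `E_m(z) = (1 - z) exp(z + z²/2 + ⋯ + z^m/m)`. -/
def weierstrassFactor (m : ℕ) (z : ℂ) : ℂ :=
  (1 - z) * Complex.exp (∑ k ∈ Finset.Icc 1 m, z ^ k / k)

/-- `Q` is the polynomial `Q_{f,σ}` of the Hadamard factorization of `f` with origin `σ`: as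
meromorphic functions (i.e. off a discrete set), with `m = d - 1`,
`f(s) = (s-σ)^{n_σ} e^{Q(s)} ∏_{ρ ≠ σ} E_m((s-σ)/(ρ-σ))^{n_ρ}`,
the product being unconditionally convergent. -/
def IsHadamardPolynomial (f : ℂ → ℂ) (σ : ℂ) (Q : Polynomial ℂ) : Prop :=
  ∀ᶠ s in codiscrete ℂ,
    (Multipliable fun ρ : {ρ : ℂ // ρ ≠ σ} ↦
      weierstrassFactor (convergenceExponent f - 1) ((s - σ) / ((ρ : ℂ) - σ)) ^ mult f ρ) ∧
    f s = (s - σ) ^ mult f σ * Complex.exp (Q.eval s) *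
      ∏' ρ : {ρ : ℂ // ρ ≠ σ},
        weierstrassFactor (convergenceExponent f - 1) ((s - σ) / ((ρ : ℂ) - σ)) ^ mult f ρ

/-! ### Inverse Laplace transform -/

/-- `F` is holomorphic on a half-plane `Re s > σ₂ > 0` with `σ₂ < c`, and
`|F(s)| |s|^{-m₀} ≤ C / |s|²` there. -/
def LaplaceAdmissible (F : ℂ → ℂ) (c : ℝ) (m₀ : ℕ) : Prop :=
  ∃ σ₂ C : ℝ, 0 < σ₂ ∧ σ₂ < c ∧ DifferentiableOn ℂ F {s | σ₂ < s.re} ∧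
    ∀ s : ℂ, σ₂ < s.re → ‖F s‖ / ‖s‖ ^ m₀ ≤ C / ‖s‖ ^ 2

/-- `L(t) = (1/2π) ∫_ℝ F(c+iu) (c+iu)^{-m₀} e^{(c+iu)t} du`. -/
def bromwich (F : ℂ → ℂ) (c : ℝ) (m₀ : ℕ) (t : ℝ) : ℂ :=
  (2 * Real.pi : ℂ)⁻¹ * ∫ u : ℝ, F (c + u * Complex.I) / ((c : ℂ) + u * Complex.I) ^ m₀ *
    Complex.exp (((c : ℂ) + u * Complex.I) * t)

/-- The inverse Laplace transform `𝓛⁻¹(F) = (D/Dt)^{m₀} L`, for admissible `c`, `m₀`. -/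
def inverseLaplace (F : ℂ → ℂ) (c : ℝ) (m₀ : ℕ) : Distr := distDeriv^[m₀] (ofFun (bromwich F c m₀))

/-- The meromorphic function `f'/f`, with removable singularities removed. -/
def logDerivative (f : ℂ → ℂ) : ℂ → ℂ := toMeromorphicNFOn (logDeriv f) Set.univ

end PoissonNewton

end

/-! The distributional identity is proved by testing both sides on `φ` and comparing integrals over
the line `Re s = c` against the Laplace transform `Φ(s) = ∫ φ(t) e^{st} dt`, which decays there
faster than any power.

*Hadamard factorization.* With `m = d - 1`, the zeros and the poles of `f` away from `τ` define
two canonical products, entire functions with `log⁺ |Π(z)| = O(1 + |z|^d)`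
(`norm_canonicalProduct_le`), hence of finite order. Dividing `f` by their quotient and by
`(s - τ)^{n_τ}` leaves a zero-free entire function of finite order. Such a function is `e^h` with
`h` entire, and the bound on its characteristic bounds the circle averages of `|Re h|` by a power
of the radius, so that all but finitely many Taylor coefficients of `h` vanish
(`exists_polynomial_of_isBigO_circleAverage`). Thus `h` is a polynomial
(`exists_isHadamardPolynomial`).

*Partial fractions.* Logarithmic differentiation gives, off the divisor,
`f'/f = Q' + n_τ / (s - τ) + ∑_{ρ ≠ τ} n_ρ (s - τ)^m / ((s - ρ) (ρ - τ)^m)`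
(`analyticAt_logDerivative`). This yields polynomial growth to the right of the divisor, hence
admissible pairs. For the two origins `0` and `σ` the series are `o(x^m)` as `x → +∞`, because the divisor
lies in a left half-plane; so `Q_σ' - Q_0'` has degree less than `m`, which bounds the degree of
the discrepancy polynomial (`degree_discrepancy_lt`).

*The identity.* By Fubini `𝓛⁻¹(f'/f)` pairs with `φ` to `(2π)⁻¹ ∫ (f'/f) Φ` over the line, and by
Fourier inversion `∑ c_j δ₀^{(j)}` pairs to `(2π)⁻¹ ∫ P Φ`, where `P = -Q'`. Their sum is the
integral of the divisor part of the partial fraction expansion. In the Newton-Cramer distribution,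
integration by parts turns the term `n_σ t^d / d!` into `(2π)⁻¹ ∫ n_σ / (s - σ) Φ`, while the
exponential of index `ρ`, with its value at `0` subtracted, gives
`n_ρ (ρ - σ)^{-d} ((s - σ)^d / (s - ρ) - (s - σ)^{d - 1})`, which is exactly the term of index `ρ`
of the series (`integral_Ioi_kernelTerm_sub`). Both interchanges of sum and integral are justified
by the convergence of `∑ |n_ρ| |ρ - σ|^{-d}`. -/

namespace PoissonNewton

section

/-! ### Weierstrass factors -/

lemma hasDerivAt_weierstrassFactor (m : ℕ) (z : ℂ) :
    HasDerivAt (weierstrassFactor m)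
      (-z ^ m * Complex.exp (∑ k ∈ Finset.Icc 1 m, z ^ k / k)) z := by
  have h1 : HasDerivAt (fun z : ℂ ↦ ∑ k ∈ Finset.Icc 1 m, z ^ k / k)
      (∑ k ∈ Finset.Icc 1 m, z ^ (k - 1)) z := by
    refine HasDerivAt.fun_sum fun k hk ↦ ?_
    have hk0 : (k : ℂ) ≠ 0 := Nat.cast_ne_zero.2 (by have := (Finset.mem_Icc.1 hk).1; omega)
    simpa [mul_div_cancel_left₀ _ hk0] using (hasDerivAt_pow k z).div_const (k : ℂ)
  have h2 : (1 - z) * ∑ k ∈ Finset.Icc 1 m, z ^ (k - 1) = 1 - z ^ m := by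
    have : ∑ k ∈ Finset.Icc 1 m, z ^ (k - 1) = ∑ k ∈ Finset.range m, z ^ k := by
      rw [← Finset.Ico_succ_right_eq_Icc, Finset.sum_Ico_eq_sum_range]
      simp [Order.succ_eq_add_one]
    rw [this, mul_comm, geom_sum_mul_neg]
  have h3 := ((hasDerivAt_const z (1 : ℂ)).sub (hasDerivAt_id z)).mul h1.cexp
  refine HasDerivAt.congr_deriv (f := weierstrassFactor m) h3 ?_
  simp only [Pi.sub_apply, id]
  linear_combination Complex.exp (∑ k ∈ Finset.Icc 1 m, z ^ k / k) * h2

lemma differentiable_weierstrassFactor (m : ℕ) : Differentiable ℂ (weierstrassFactor m) :=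
  fun z ↦ (hasDerivAt_weierstrassFactor m z).differentiableAt

@[simp] lemma weierstrassFactor_zero (m : ℕ) : weierstrassFactor m 0 = 1 := by
  have : ∑ k ∈ Finset.Icc 1 m, (0 : ℂ) ^ k / k = 0 := Finset.sum_eq_zero fun k hk ↦ by
    rw [zero_pow (by have := (Finset.mem_Icc.1 hk).1; omega), zero_div]
  simp [weierstrassFactor, this]

lemma weierstrassFactor_eq_zero_iff {m : ℕ} {z : ℂ} : weierstrassFactor m z = 0 ↔ z = 1 := by
  rw [weierstrassFactor, mul_eq_zero, or_iff_left (Complex.exp_ne_zero _), sub_eq_zero, eq_comm]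

lemma norm_exp_sum_le (m : ℕ) {z : ℂ} {r : ℝ} (hz : ‖z‖ ≤ r) (hr : r ≤ 1) :
    ‖Complex.exp (∑ k ∈ Finset.Icc 1 m, z ^ k / k)‖ ≤ Real.exp m := by
  refine (Complex.norm_exp_le_exp_norm _).trans (Real.exp_le_exp.2 ?_)
  calc ‖∑ k ∈ Finset.Icc 1 m, z ^ k / k‖ ≤ ∑ k ∈ Finset.Icc 1 m, (1 : ℝ) := by
        refine norm_sum_le_of_le _ fun k hk ↦ ?_
        have hk1 : (1 : ℝ) ≤ k := by exact_mod_cast (Finset.mem_Icc.1 hk).1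
        rw [norm_div, norm_pow, Complex.norm_natCast, div_le_one (by linarith)]
        exact (pow_le_one₀ (norm_nonneg _) (hz.trans hr)).trans hk1
    _ = m := by simp

/-- The Weierstrass factor is close to `1` to order `m + 1` at the origin, since its derivative
`-z ^ m exp (z + ⋯ + z ^ m / m)` vanishes there to order `m`. -/
lemma norm_weierstrassFactor_sub_one_le (m : ℕ) {z : ℂ} (hz : ‖z‖ ≤ 1) :
    ‖weierstrassFactor m z - 1‖ ≤ Real.exp m * ‖z‖ ^ (m + 1) := by
  have h := (convex_closedBall (0 : ℂ) ‖z‖).norm_image_sub_le_of_norm_hasDerivWithin_le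
    (f := weierstrassFactor m) (C := Real.exp m * ‖z‖ ^ m) (x := 0) (y := z)
    (fun w _ ↦ (hasDerivAt_weierstrassFactor m w).hasDerivWithinAt) ?_ (by simp) (by simp)
  · simpa [pow_succ, mul_assoc] using h
  · intro w hw
    have hw' : ‖w‖ ≤ ‖z‖ := by simpa using hw
    rw [norm_mul, norm_neg, norm_pow, mul_comm]
    gcongr
    exact norm_exp_sum_le m hw' hz

lemma norm_weierstrassFactor_le (m : ℕ) (z : ℂ) :
    ‖weierstrassFactor m z‖ ≤ Real.exp ((Real.exp m + m + 1) * ‖z‖ ^ (m + 1)) := by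
  rcases le_total ‖z‖ 1 with hz | hz
  · have h := norm_weierstrassFactor_sub_one_le m hz
    calc ‖weierstrassFactor m z‖ ≤ ‖weierstrassFactor m z - 1‖ + ‖(1 : ℂ)‖ := by
          simpa using norm_add_le (weierstrassFactor m z - 1) 1
      _ ≤ Real.exp m * ‖z‖ ^ (m + 1) + 1 := by rw [norm_one]; gcongr
      _ ≤ Real.exp (Real.exp m * ‖z‖ ^ (m + 1)) := Real.add_one_le_exp _
      _ ≤ _ := by
        gcongr
        have : (0 : ℝ) ≤ m := m.cast_nonneg
        linarith
  · rw [weierstrassFactor, norm_mul]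
    have hz1 : ‖z‖ ≤ ‖z‖ ^ (m + 1) := by
      simpa using pow_le_pow_right₀ hz (show 1 ≤ m + 1 by omega)
    have h1 : ‖1 - z‖ ≤ Real.exp (‖z‖ ^ (m + 1)) := by
      calc ‖1 - z‖ ≤ ‖z‖ + 1 := by
            have := norm_sub_le (1 : ℂ) z
            rw [norm_one] at this; linarith
        _ ≤ Real.exp ‖z‖ := Real.add_one_le_exp _
        _ ≤ _ := by gcongr
    have h2 : ‖Complex.exp (∑ k ∈ Finset.Icc 1 m, z ^ k / k)‖ ≤
        Real.exp (m * ‖z‖ ^ (m + 1)) := by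
      refine (Complex.norm_exp_le_exp_norm _).trans (Real.exp_le_exp.2 ?_)
      calc ‖∑ k ∈ Finset.Icc 1 m, z ^ k / k‖ ≤ ∑ k ∈ Finset.Icc 1 m, ‖z‖ ^ (m + 1) := by
            refine norm_sum_le_of_le _ fun k hk ↦ ?_
            have hk' := Finset.mem_Icc.1 hk
            have hk1 : (1 : ℝ) ≤ k := by exact_mod_cast hk'.1
            rw [norm_div, norm_pow, Complex.norm_natCast]
            exact (div_le_self (by positivity) hk1).trans
              (pow_le_pow_right₀ hz (by omega))
        _ = _ := by simp
    calc _ ≤ Real.exp (‖z‖ ^ (m + 1)) * Real.exp (m * ‖z‖ ^ (m + 1)) := by gcongr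
      _ = Real.exp ((m + 1) * ‖z‖ ^ (m + 1)) := by rw [← Real.exp_add]; ring_nf
      _ ≤ _ := by
        gcongr
        linarith [Real.exp_pos m]

lemma logDeriv_weierstrassFactor (m : ℕ) {z : ℂ} :
    logDeriv (weierstrassFactor m) z = z ^ m / (z - 1) := by
  rw [logDeriv_apply, (hasDerivAt_weierstrassFactor m z).deriv, weierstrassFactor,
    mul_div_mul_right _ _ (Complex.exp_ne_zero _), neg_div, ← div_neg, neg_sub]

/-! ### Canonical products -/

section CanonicalProduct

variable {ι : Type*} {m : ℕ} {a : ι → ℂ}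

/-- The canonical product `∏ E_m(z / a_i) ^ ν_i`. -/
noncomputable def canonicalProduct (m : ℕ) (a : ι → ℂ) (ν : ι → ℕ) (z : ℂ) : ℂ :=
  ∏' i, weierstrassFactor m (z / a i) ^ ν i

/-- Only finitely many points of a divisor with a convergent series `∑ |ν_i| / |a_i| ^ N` lie in a
given disc. -/
lemma eventually_le_norm_of_summable (ha : ∀ i, a i ≠ 0) {ν : ι → ℤ} {N : ℕ}
    (hs : Summable fun i ↦ |(ν i : ℝ)| / ‖a i‖ ^ N) (R : ℝ) :
    ∀ᶠ i in cofinite, ν i ≠ 0 → R ≤ ‖a i‖ := by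
  have hR : 0 < (|R| + 1) ^ N := by positivity
  filter_upwards [hs.tendsto_cofinite_zero.eventually (gt_mem_nhds (inv_pos.2 hR))] with i hi hν
  by_contra! hlt
  have h1 : (1 : ℝ) ≤ |(ν i : ℝ)| := by exact_mod_cast Int.one_le_abs hν
  have h0 : 0 < ‖a i‖ := norm_pos_iff.2 (ha i)
  have h2 : ‖a i‖ ^ N ≤ (|R| + 1) ^ N := by
    gcongr
    linarith [le_abs_self R]
  have h3 : ((|R| + 1) ^ N)⁻¹ ≤ |(ν i : ℝ)| / ‖a i‖ ^ N := by
    rw [← one_div]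
    gcongr
  linarith

lemma norm_pow_sub_one_le (w : ℂ) (n : ℕ) :
    ‖w ^ n - 1‖ ≤ n * ‖w - 1‖ * Real.exp (n * ‖w - 1‖) := by
  have h := Finset.norm_prod_one_add_sub_one_le (Finset.range n) (fun _ ↦ w - 1)
  simp only [add_sub_cancel, Finset.prod_const, Finset.card_range, Finset.sum_const,
    nsmul_eq_mul] at h
  refine h.trans ?_
  set x := (n : ℝ) * ‖w - 1‖
  have h1 : 1 - x ≤ Real.exp (-x) := by linarith [Real.add_one_le_exp (-x)]
  have h2 : Real.exp (-x) * Real.exp x = 1 := by rw [← Real.exp_add]; simp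
  nlinarith [Real.exp_pos x]

/-- On a disc the factors of a canonical product are uniformly summably close to `1`. -/
lemma exists_summable_norm_factor_sub_one_le (ha : ∀ i, a i ≠ 0) {ν : ι → ℕ}
    (hs : Summable fun i ↦ (ν i : ℝ) / ‖a i‖ ^ (m + 1)) (R : ℝ) :
    ∃ u : ι → ℝ, Summable u ∧ ∀ᶠ i in cofinite, ∀ z ∈ Metric.ball (0 : ℂ) R,
      ‖weierstrassFactor m (z / a i) ^ ν i - 1‖ ≤ u i := by
  set c := Real.exp m
  set B := c * (|R| + 1) ^ (m + 1)
  have hB : 0 < B := by positivity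
  refine ⟨fun i ↦ B * Real.exp 1 * ((ν i : ℝ) / ‖a i‖ ^ (m + 1)), hs.mul_left _, ?_⟩
  have hs' : Summable fun i ↦ |((ν i : ℤ) : ℝ)| / ‖a i‖ ^ (m + 1) := by simpa using hs
  filter_upwards [eventually_le_norm_of_summable ha hs' (|R| + 1),
    hs.tendsto_cofinite_zero.eventually (gt_mem_nhds (inv_pos.2 hB))] with i hi hi' z hz
  rcases Nat.eq_zero_or_pos (ν i) with h0 | h0
  · simp [h0]
  have hai : |R| + 1 ≤ ‖a i‖ := hi (by exact_mod_cast h0.ne')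
  have hai0 : 0 < ‖a i‖ := norm_pos_iff.2 (ha i)
  have hzR : ‖z‖ ≤ |R| + 1 := by
    have := mem_ball_zero_iff.1 hz
    linarith [le_abs_self R]
  have hza : ‖z / a i‖ ≤ 1 := by
    rw [norm_div]
    exact div_le_one_of_le₀ (hzR.trans hai) hai0.le
  have hx : ν i * ‖weierstrassFactor m (z / a i) - 1‖ ≤ B * ((ν i : ℝ) / ‖a i‖ ^ (m + 1)) := by
    calc ν i * ‖weierstrassFactor m (z / a i) - 1‖
        ≤ ν i * (c * ‖z / a i‖ ^ (m + 1)) := by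
          gcongr
          exact norm_weierstrassFactor_sub_one_le m hza
      _ = c * ‖z‖ ^ (m + 1) * ((ν i : ℝ) / ‖a i‖ ^ (m + 1)) := by
          rw [norm_div, div_pow]; ring
      _ ≤ _ := by
          gcongr
          exact mul_le_mul_of_nonneg_left (pow_le_pow_left₀ (norm_nonneg _) hzR _)
            (Real.exp_pos _).le
  have hx1 : ν i * ‖weierstrassFactor m (z / a i) - 1‖ ≤ 1 := by
    refine hx.trans ?_
    have := mul_le_mul_of_nonneg_left hi'.le hB.le
    rwa [mul_inv_cancel₀ hB.ne'] at this
  calc _ ≤ _ := norm_pow_sub_one_le _ _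
    _ ≤ B * ((ν i : ℝ) / ‖a i‖ ^ (m + 1)) * Real.exp 1 := by gcongr
    _ = _ := by ring

variable (ha : ∀ i, a i ≠ 0) {ν : ι → ℕ} (hs : Summable fun i ↦ (ν i : ℝ) / ‖a i‖ ^ (m + 1))

lemma differentiable_factor (m : ℕ) (b : ℂ) (n : ℕ) :
    Differentiable ℂ fun z ↦ weierstrassFactor m (z / b) ^ n :=
  ((differentiable_weierstrassFactor m).comp (differentiable_id.div_const b)).pow n

include ha hs

lemma hasProdLocallyUniformlyOn_canonicalProduct (R : ℝ) :
    HasProdLocallyUniformlyOn (fun i z ↦ weierstrassFactor m (z / a i) ^ ν i)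
      (canonicalProduct m a ν) (Metric.ball 0 R) := by
  obtain ⟨u, hu, hb⟩ := exists_summable_norm_factor_sub_one_le ha hs R
  simpa [canonicalProduct] using! Summable.hasProdLocallyUniformlyOn_one_add
    (f := fun i z ↦ weierstrassFactor m (z / a i) ^ ν i - 1) Metric.isOpen_ball hu hb
    fun i ↦ ((differentiable_factor m (a i) (ν i)).continuous.sub continuous_const).continuousOn

lemma differentiable_canonicalProduct : Differentiable ℂ (canonicalProduct m a ν) := by
  intro z
  have h := (hasProdLocallyUniformlyOn_canonicalProduct ha hs (‖z‖ + 1))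
  have hd : DifferentiableOn ℂ (canonicalProduct m a ν) (Metric.ball 0 (‖z‖ + 1)) :=
    TendstoLocallyUniformlyOn.differentiableOn h
      (Eventually.of_forall fun s ↦ by
        refine DifferentiableOn.fun_finsetProd fun i _ ↦ ?_
        exact (differentiable_factor m (a i) (ν i)).differentiableOn) Metric.isOpen_ball
  exact hd.differentiableAt (Metric.isOpen_ball.mem_nhds (by simp))

lemma summable_norm_factor_sub_one (z : ℂ) :
    Summable fun i ↦ ‖weierstrassFactor m (z / a i) ^ ν i - 1‖ := by
  obtain ⟨u, hu, hb⟩ := exists_summable_norm_factor_sub_one_le ha hs (‖z‖ + 1)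
  refine Summable.of_norm_bounded_eventually hu (hb.mono fun i hi ↦ ?_)
  simpa using hi z (by simp)

lemma multipliable_factor (z : ℂ) : Multipliable fun i ↦ weierstrassFactor m (z / a i) ^ ν i := by
  simpa using multipliable_one_add_of_summable (summable_norm_factor_sub_one ha hs z)

lemma canonicalProduct_ne_zero {z : ℂ} (hz : ∀ i, ν i ≠ 0 → z ≠ a i) :
    canonicalProduct m a ν z ≠ 0 := by
  have := tprod_one_add_ne_zero_of_summable
    (f := fun i ↦ weierstrassFactor m (z / a i) ^ ν i - 1) ?_
    (summable_norm_factor_sub_one ha hs z)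
  · simpa [canonicalProduct] using this
  · intro i
    rw [add_sub_cancel]
    by_cases hi : ν i = 0
    · simp [hi]
    · refine pow_ne_zero _ fun h ↦ hz i hi ?_
      rwa [weierstrassFactor_eq_zero_iff, div_eq_one_iff_eq (ha i)] at h

lemma norm_canonicalProduct_le (z : ℂ) :
    ‖canonicalProduct m a ν z‖ ≤
      Real.exp ((Real.exp m + m + 1) * (∑' i, (ν i : ℝ) / ‖a i‖ ^ (m + 1)) * ‖z‖ ^ (m + 1)) := by
  refine le_of_tendsto (multipliable_factor ha hs z).hasProd.norm
    (Eventually.of_forall fun s ↦ ?_)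
  calc ∏ i ∈ s, ‖weierstrassFactor m (z / a i) ^ ν i‖
      ≤ ∏ i ∈ s, Real.exp ((Real.exp m + m + 1) *
          ((ν i : ℝ) / ‖a i‖ ^ (m + 1)) * ‖z‖ ^ (m + 1)) := by
        refine Finset.prod_le_prod (fun _ _ ↦ norm_nonneg _) fun i _ ↦ ?_
        rw [norm_pow]
        calc _ ≤ Real.exp ((Real.exp m + m + 1) * ‖z / a i‖ ^ (m + 1)) ^ ν i := by
              gcongr
              exact norm_weierstrassFactor_le _ _
          _ = _ := by rw [← Real.exp_nat_mul, norm_div, div_pow]; ring_nf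
    _ = Real.exp ((Real.exp m + m + 1) *
          (∑ i ∈ s, (ν i : ℝ) / ‖a i‖ ^ (m + 1)) * ‖z‖ ^ (m + 1)) := by
        rw [← Real.exp_sum, Finset.mul_sum, Finset.sum_mul]
    _ ≤ _ := by
        gcongr
        exact hs.sum_le_tsum s fun i _ ↦ by positivity

/-- At one of its zeros a canonical product with pairwise distinct points `a_i` vanishes to the
prescribed order. -/
lemma meromorphicOrderAt_canonicalProduct (hinj : Function.Injective a) (j : ι) :
    meromorphicOrderAt (canonicalProduct m a ν) (a j) = ν j := by
  classical
  have hle : ∀ i, Function.update ν j 0 i ≤ ν i := fun i ↦ by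
    rcases eq_or_ne i j with rfl | h <;> simp [*]
  have hs' : Summable fun i ↦ (Function.update ν j 0 i : ℝ) / ‖a i‖ ^ (m + 1) :=
    hs.of_nonneg_of_le (fun i ↦ by positivity) fun i ↦ by
      gcongr
      exact hle i
  -- Setting the multiplicity of `j` to `0` leaves a product that does not vanish at `a j`.
  have hsplit : canonicalProduct m a ν = fun z ↦ (z - a j) ^ ν j *
      ((-(a j)⁻¹ * Complex.exp (∑ k ∈ Finset.Icc 1 m, (z / a j) ^ k / k)) ^ ν j *
        canonicalProduct m a (Function.update ν j 0) z) := by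
    ext z
    have h1 : canonicalProduct m a ν z = weierstrassFactor m (z / a j) ^ ν j *
        canonicalProduct m a (Function.update ν j 0) z := by
      rw [canonicalProduct, Multipliable.tprod_eq_mul_tprod_ite' j]
      · congr 1
        refine tprod_congr fun i ↦ ?_
        rcases eq_or_ne i j with rfl | h <;> simp [*]
      · convert! multipliable_factor ha hs' z using 2 with i
        rcases eq_or_ne i j with rfl | h <;> simp [*]
    have h2 : weierstrassFactor m (z / a j) = (z - a j) *
        (-(a j)⁻¹ * Complex.exp (∑ k ∈ Finset.Icc 1 m, (z / a j) ^ k / k)) := by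
      rw [weierstrassFactor, ← mul_assoc]
      congr 1
      have := ha j
      field_simp
      ring
    rw [h1, h2, mul_pow, mul_assoc]
  have hg : Differentiable ℂ fun z ↦
      ((-(a j)⁻¹ * Complex.exp (∑ k ∈ Finset.Icc 1 m, (z / a j) ^ k / k)) ^ ν j *
        canonicalProduct m a (Function.update ν j 0) z) := by
    have := differentiable_canonicalProduct ha hs'
    fun_prop
  refine (meromorphicOrderAt_eq_int_iff (n := ν j)
    ((differentiable_canonicalProduct ha hs).analyticAt (a j)).meromorphicAt).2
    ⟨_, hg.analyticAt _, ?_, Eventually.of_forall fun z ↦ by rw [hsplit]; simp⟩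
  refine mul_ne_zero (pow_ne_zero _ (mul_ne_zero ?_ (Complex.exp_ne_zero _)))
    (canonicalProduct_ne_zero ha hs' fun i hi h ↦ ?_)
  · exact neg_ne_zero.2 (inv_ne_zero (ha j))
  · rw [← hinj h] at hi
    simp at hi

lemma meromorphicOrderAt_canonicalProduct_eq_zero {z : ℂ} (hz : ∀ i, ν i ≠ 0 → z ≠ a i) :
    meromorphicOrderAt (canonicalProduct m a ν) z = 0 := by
  have h := (differentiable_canonicalProduct ha hs).analyticAt z
  exact h.meromorphicNFAt.meromorphicOrderAt_eq_zero_iff.2 (canonicalProduct_ne_zero ha hs hz)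

omit hs in
lemma logDeriv_factor {i : ι} {z : ℂ} (hz : ν i ≠ 0 → z ≠ a i) :
    logDeriv (fun z ↦ weierstrassFactor m (z / a i) ^ ν i) z =
      ν i * (z ^ m / ((z - a i) * a i ^ m)) := by
  have hd : DifferentiableAt ℂ (fun z ↦ weierstrassFactor m (z / a i)) z :=
    (differentiable_weierstrassFactor m _).comp z (differentiableAt_id.div_const _)
  rw [logDeriv_fun_pow hd]
  have h1 : logDeriv (fun z ↦ weierstrassFactor m (z / a i)) z =
      logDeriv (weierstrassFactor m) (z / a i) * (1 / a i) := by
    have := logDeriv_comp (f := weierstrassFactor m) (g := fun z ↦ z / a i) (x := z)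
      (differentiable_weierstrassFactor m _) (by fun_prop)
    simpa [Function.comp_def] using this
  rw [h1, logDeriv_weierstrassFactor]
  by_cases h : ν i = 0
  · simp [h]
  · have h2 := sub_ne_zero.2 (hz h)
    have h3 := ha i
    have h4 : z / a i - 1 ≠ 0 := by
      rw [sub_ne_zero, Ne, div_eq_one_iff_eq h3]; exact hz h
    rw [div_pow]
    field_simp

omit hs in
/-- The partial fraction series of the logarithmic derivative converges absolutely. -/
lemma summable_norm_partialFraction {k : ι → ℤ}
    (hk : Summable fun i ↦ |(k i : ℝ)| / ‖a i‖ ^ (m + 1)) (z : ℂ) :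
    Summable fun i ↦ ‖k i * (z ^ m / ((z - a i) * a i ^ m))‖ := by
  refine Summable.of_norm_bounded_eventually (hk.mul_left (2 * ‖z‖ ^ m)) ?_
  filter_upwards [eventually_le_norm_of_summable ha hk (2 * ‖z‖)] with i hi
  rw [norm_norm]
  by_cases h : k i = 0
  · simp [h]
  have h1 := hi h
  have h0 : 0 < ‖a i‖ := norm_pos_iff.2 (ha i)
  have h2 : ‖a i‖ / 2 ≤ ‖z - a i‖ := by
    have := norm_sub_norm_le (a i) z
    rw [norm_sub_rev] at this
    linarith
  simp only [norm_mul, norm_div, norm_pow, Complex.norm_intCast]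
  calc |(k i : ℝ)| * (‖z‖ ^ m / (‖z - a i‖ * ‖a i‖ ^ m))
      ≤ |(k i : ℝ)| * (‖z‖ ^ m / (‖a i‖ / 2 * ‖a i‖ ^ m)) := by gcongr
    _ = _ := by field_simp; ring

lemma logDeriv_canonicalProduct {z : ℂ} (hz : ∀ i, ν i ≠ 0 → z ≠ a i) :
    logDeriv (canonicalProduct m a ν) z =
      ∑' i, (ν i : ℂ) * (z ^ m / ((z - a i) * a i ^ m)) := by
  have hs' : Summable fun i ↦ |((ν i : ℤ) : ℝ)| / ‖a i‖ ^ (m + 1) := by simpa using hs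
  have hsum := (summable_norm_partialFraction ha hs' z).of_norm
  have hterm : ∀ i, logDeriv (fun z ↦ weierstrassFactor m (z / a i) ^ ν i) z =
      (ν i : ℂ) * (z ^ m / ((z - a i) * a i ^ m)) := fun i ↦ logDeriv_factor ha (hz i)
  have h := logDeriv_tprod_eq_tsum (f := fun i z ↦ weierstrassFactor m (z / a i) ^ ν i)
    (x := z) (s := Metric.ball 0 (‖z‖ + 1)) Metric.isOpen_ball (by simp) (fun i ↦ ?_)
    (fun i ↦ (differentiable_factor m (a i) (ν i)).differentiableOn) ?_
    (hasProdLocallyUniformlyOn_canonicalProduct ha hs _).multipliableLocallyUniformlyOn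
    (canonicalProduct_ne_zero ha hs hz)
  · simp only [hterm] at h
    exact h
  · by_cases hi : ν i = 0
    · simp [hi]
    · refine pow_ne_zero _ fun h ↦ hz i hi ?_
      rwa [weierstrassFactor_eq_zero_iff, div_eq_one_iff_eq (ha i)] at h
  · simpa [hterm] using hsum

end CanonicalProduct

end

section

/-! ### Entire functions with real part of polynomial growth in the mean -/

/-- A zero-free entire function has an entire logarithm, a primitive of its logarithmic
derivative. -/
lemma exists_differentiable_exp_eq {H : ℂ → ℂ} (hH : Differentiable ℂ H) (h0 : ∀ z, H z ≠ 0) :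
    ∃ h : ℂ → ℂ, Differentiable ℂ h ∧ ∀ z, H z = Complex.exp (h z) := by
  have hd : Differentiable ℂ fun z ↦ deriv H z / H z :=
    ((hH.contDiff (n := 2)).differentiable_deriv_two).div hH h0
  obtain ⟨h, hh0, hh⟩ := hd.isExactOn_univ.with_val_at 0 (Complex.log (H 0))
  refine ⟨h, fun z ↦ (hh z trivial).differentiableAt, fun z ↦ ?_⟩
  have hconst : ∀ w, HasDerivAt (fun z ↦ H z * Complex.exp (-h z)) 0 w := fun w ↦ by
    refine ((hH w).hasDerivAt.mul (hh w trivial).neg.cexp).congr_deriv ?_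
    have := h0 w
    field_simp
    ring
  have h1 := is_const_of_deriv_eq_zero (fun w ↦ (hconst w).differentiableAt)
    (fun w ↦ (hconst w).deriv) z 0
  simp only [hh0] at h1
  rw [Complex.exp_neg, Complex.exp_neg, Complex.exp_log (h0 0), mul_inv_cancel₀ (h0 0)] at h1
  rw [← mul_inv_eq_one₀ (Complex.exp_ne_zero _), h1]

lemma norm_circleAverage_le (f : ℂ → ℂ) (r : ℝ) :
    ‖Real.circleAverage f 0 r‖ ≤ Real.circleAverage (fun z ↦ ‖f z‖) 0 r := by
  rw [Real.circleAverage_def, Real.circleAverage_def, norm_smul, smul_eq_mul, Real.norm_of_nonneg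
    (by positivity)]
  gcongr
  exact intervalIntegral.norm_integral_le_integral_norm (by positivity)

/-- A Taylor coefficient of positive index is bounded by the mean of `|Re h|`, because the conjugate
of `h` is orthogonal to `z ^ k` on circles. -/
lemma norm_iteratedDeriv_mul_pow_le {h : ℂ → ℂ} (hd : Differentiable ℂ h) {k : ℕ} (hk : k ≠ 0)
    {r : ℝ} (hr : 0 < r) :
    ‖iteratedDeriv k h 0‖ / k.factorial * r ^ k ≤
      2 * Real.circleAverage (fun z ↦ |(h z).re|) 0 r := by
  have hcont := hd.continuous
  have hci : ∀ {F : ℂ → ℂ}, Continuous F → CircleIntegrable F 0 r :=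
    fun hF ↦ hF.continuousOn.circleIntegrable hr.le
  have hconj : ∀ z ∈ Metric.sphere (0 : ℂ) |r|, z ≠ 0 ∧ starRingEnd ℂ z = r ^ 2 / z := by
    intro z hz
    have hz' : ‖z‖ = r := by simpa [abs_of_pos hr] using hz
    have hz0 : z ≠ 0 := norm_pos_iff.1 (hz' ▸ hr)
    refine ⟨hz0, ?_⟩
    rw [eq_div_iff hz0, mul_comm, Complex.mul_conj, Complex.normSq_eq_norm_sq, hz']
    push_cast; rfl
  have h1 : Real.circleAverage (fun z ↦ h z * (starRingEnd ℂ z) ^ k) 0 r =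
      r ^ (2 * k) * (iteratedDeriv k h 0 / k.factorial) := by
    rw [Real.circleAverage_congr_sphere (f₂ := fun z ↦ (r : ℂ) ^ (2 * k) • (h z / z ^ k)),
      Real.circleAverage_fun_smul, Real.circleAverage_eq_circleIntegral hr.ne', smul_eq_mul]
    · congr 1
      have := DifferentiableOn.circleIntegral_one_div_sub_center_pow_smul hr k
        (hd.differentiableOn (s := Metric.closedBall 0 r))
      have h2 : (∮ z in C(0, r), (z - 0)⁻¹ • (h z / z ^ k)) =
          (2 * Real.pi * Complex.I / k.factorial) • iteratedDeriv k h 0 := by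
        rw [← this]
        congr 1
        ext z
        simp only [sub_zero, smul_eq_mul, pow_succ]
        rw [one_div, mul_inv]
        ring
      rw [h2]
      have := Complex.two_pi_I_ne_zero
      simp only [smul_eq_mul]
      field_simp
    · intro z hz
      obtain ⟨hz0, hz1⟩ := hconj z hz
      simp only [hz1, div_pow, smul_eq_mul]
      ring
  have h2 : Real.circleAverage (fun z ↦ starRingEnd ℂ (h z) * (starRingEnd ℂ z) ^ k) 0 r = 0 := by
    have := Complex.conjCLE.toContinuousLinearMap.circleAverage_comp_comm (c := 0) (R := r)
      (f := fun z ↦ h z * z ^ k) (hci (by fun_prop))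
    rw [DiffContOnCl.circleAverage (f := fun z ↦ h z * z ^ k)
      (Differentiable.diffContOnCl (by fun_prop))] at this
    simpa [Function.comp_def, hk] using this
  have h3 : r ^ (2 * k) * (iteratedDeriv k h 0 / k.factorial) =
      Real.circleAverage (fun z ↦ ((2 * (h z).re : ℝ) : ℂ) * (starRingEnd ℂ z) ^ k) 0 r := by
    have h := Real.circleAverage_fun_add (c := 0) (R := r)
      (f₁ := fun z ↦ h z * (starRingEnd ℂ z) ^ k)
      (f₂ := fun z ↦ starRingEnd ℂ (h z) * (starRingEnd ℂ z) ^ k)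
      (hci (by fun_prop)) (hci (by fun_prop))
    rw [h2, add_zero, h1] at h
    rw [← h]
    congr 1
    ext z
    rw [← add_mul, Complex.add_conj]
  have h4 : r ^ (2 * k) * (‖iteratedDeriv k h 0‖ / k.factorial) ≤
      2 * r ^ k * Real.circleAverage (fun z ↦ |(h z).re|) 0 r := by
    have h5 := norm_circleAverage_le
      (fun z ↦ ((2 * (h z).re : ℝ) : ℂ) * (starRingEnd ℂ z) ^ k) r
    rw [← h3, Real.circleAverage_congr_sphere (f₂ := fun z ↦ (2 * r ^ k) • |(h z).re|),
      Real.circleAverage_fun_smul] at h5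
    · simpa [abs_of_pos hr] using h5
    · intro z hz
      have hz' : ‖z‖ = r := by simpa [abs_of_pos hr] using hz
      simp only [norm_mul, norm_pow, RCLike.norm_conj, hz', Complex.norm_real, smul_eq_mul,
        Real.norm_eq_abs, abs_two]
      ring
  have hrk : 0 < r ^ k := by positivity
  rw [show r ^ (2 * k) = r ^ k * r ^ k by ring] at h4
  nlinarith

/-- An entire function whose positive real part has mean of polynomial growth on circles is a
polynomial. -/
lemma exists_polynomial_of_isBigO_circleAverage {h : ℂ → ℂ} (hd : Differentiable ℂ h) {K : ℕ}
    (hO : Real.circleAverage (fun z ↦ max (h z).re 0) 0 =O[atTop] fun r : ℝ ↦ r ^ K) :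
    ∃ Q : Polynomial ℂ, ∀ z, h z = Q.eval z := by
  have hcont := hd.continuous
  have hzero : ∀ k > K, iteratedDeriv k h 0 = 0 := by
    intro k hk
    by_contra hne
    obtain ⟨C, hC⟩ := hO.bound
    set a := ‖iteratedDeriv k h 0‖ / k.factorial
    have ha : 0 < a := by have := norm_pos_iff.2 hne; positivity
    have hlim : Tendsto (fun r : ℝ ↦ r ^ (k - K)) atTop atTop :=
      tendsto_pow_atTop (by omega)
    obtain ⟨r, hr1, hrC, hrbig⟩ := ((eventually_ge_atTop (1 : ℝ)).and (hC.and
      (hlim.eventually_gt_atTop ((4 * C + 2 * |(h 0).re|) / a)))).exists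
    have hr : 0 < r := by linarith
    have hci : ∀ {F : ℂ → ℝ}, Continuous F → CircleIntegrable F 0 r :=
      fun hF ↦ hF.continuousOn.circleIntegrable hr.le
    -- The mean of `|Re h|` is twice that of `(Re h)⁺` minus the mean `Re h(0)` of `Re h`.
    have h1 := norm_iteratedDeriv_mul_pow_le hd (show k ≠ 0 by omega) hr
    have h2 : Real.circleAverage (fun z ↦ |(h z).re|) 0 r =
        2 * Real.circleAverage (fun z ↦ max (h z).re 0) 0 r - (h 0).re := by
      have h3 : Real.circleAverage (fun z ↦ (h z).re) 0 r = (h 0).re := by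
        have := Complex.reCLM.circleAverage_comp_comm (c := 0) (R := r) (f := h)
          (hcont.continuousOn.circleIntegrable hr.le)
        rw [DiffContOnCl.circleAverage hd.diffContOnCl] at this
        simpa [Function.comp_def] using this
      have h4 : (fun z ↦ |(h z).re|) = fun z ↦ (2 : ℝ) • max (h z).re 0 - (h z).re := by
        ext z
        rcases le_total 0 (h z).re with h | h
        · rw [abs_of_nonneg h, max_eq_left h, smul_eq_mul]; ring
        · rw [abs_of_nonpos h, max_eq_right h, smul_eq_mul]; ring
      rw [h4, Real.circleAverage_fun_sub (hci (by fun_prop)) (hci (by fun_prop)),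
        Real.circleAverage_fun_smul, h3, smul_eq_mul]
    rw [h2] at h1
    rw [Real.norm_of_nonneg (by positivity : 0 ≤ r ^ K)] at hrC
    have h5 := (Real.le_norm_self _).trans hrC
    have hrK : 1 ≤ r ^ K := one_le_pow₀ hr1
    have h6 : a * r ^ k ≤ (4 * C + 2 * |(h 0).re|) * r ^ K := by
      have h7 := neg_abs_le (h 0).re
      have h8 : |(h 0).re| ≤ |(h 0).re| * r ^ K := le_mul_of_one_le_right (abs_nonneg _) hrK
      linarith
    rw [div_lt_iff₀ ha] at hrbig
    have h9 : r ^ k = r ^ (k - K) * r ^ K := by rw [← pow_add]; congr 1; omega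
    rw [h9] at h6
    have : (4 * C + 2 * |(h 0).re|) * r ^ K < r ^ (k - K) * a * r ^ K := by gcongr
    linarith
  refine ⟨∑ n ∈ Finset.range (K + 1),
    Polynomial.monomial n ((n.factorial : ℂ)⁻¹ * iteratedDeriv n h 0), fun z ↦ ?_⟩
  have := (Complex.hasSum_taylorSeries_of_entire hd 0 z)
  rw [← this.tsum_eq, tsum_eq_sum (s := Finset.range (K + 1)), Polynomial.eval_finsetSum]
  · refine Finset.sum_congr rfl fun n _ ↦ ?_
    simp only [sub_zero, smul_eq_mul, Polynomial.eval_monomial]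
    ring
  · intro n hn
    rw [hzero n (by simpa using hn)]
    simp

end

section

/-! ### Meromorphic functions of finite order -/

lemma isBigO_pow_of_le {k l : ℕ} (hkl : k ≤ l) :
    (fun r : ℝ ↦ r ^ k) =O[atTop] fun r : ℝ ↦ r ^ l :=
  Asymptotics.IsBigO.of_bound 1 <| by
    filter_upwards [eventually_ge_atTop 1] with r hr
    rw [one_mul, norm_pow, norm_pow]
    exact pow_le_pow_right₀ (by rwa [Real.norm_of_nonneg (by linarith)]) hkl

lemma IsMeromorphicOfFiniteOrder.mul {F G : ℂ → ℂ} (hF : IsMeromorphicOfFiniteOrder F)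
    (hG : IsMeromorphicOfFiniteOrder G) (hF' : ∀ z, meromorphicOrderAt F z ≠ ⊤)
    (hG' : ∀ z, meromorphicOrderAt G z ≠ ⊤) : IsMeromorphicOfFiniteOrder (F * G) := by
  obtain ⟨hFm, k, hk⟩ := hF
  obtain ⟨hGm, l, hl⟩ := hG
  refine ⟨hFm.mul hGm, max k l, ?_⟩
  refine Asymptotics.IsBigO.trans ?_ ((hk.trans (isBigO_pow_of_le (le_max_left k l))).add
    (hl.trans (isBigO_pow_of_le (le_max_right k l))))
  refine Asymptotics.IsBigO.of_bound 1 ?_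
  filter_upwards [eventually_ge_atTop 1] with r hr
  rw [one_mul, Real.norm_of_nonneg (ValueDistribution.characteristic_nonneg hr)]
  exact (ValueDistribution.characteristic_mul_top_le hr hFm hF' hGm hG').trans
    (Real.le_norm_self _)

/-- Finite order is inherited by the reciprocal, by the first main theorem. -/
lemma IsMeromorphicOfFiniteOrder.inv {F : ℂ → ℂ} (hF : IsMeromorphicOfFiniteOrder F) :
    IsMeromorphicOfFiniteOrder F⁻¹ := by
  obtain ⟨hFm, k, hk⟩ := hF
  refine ⟨hFm.inv, k, ?_⟩
  have h := ValueDistribution.isBigO_characteristic_sub_characteristic_inv hFm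
  have h1 : (1 : ℝ → ℝ) =O[atTop] fun r : ℝ ↦ r ^ k := by
    simpa using! isBigO_pow_of_le (Nat.zero_le k)
  simpa using hk.sub (h.trans h1)

lemma IsMeromorphicOfFiniteOrder.pow {F : ℂ → ℂ} (hF : IsMeromorphicOfFiniteOrder F) (n : ℕ) :
    IsMeromorphicOfFiniteOrder (F ^ n) := by
  obtain ⟨hFm, k, hk⟩ := hF
  refine ⟨fun z ↦ (hFm z).pow n, k, ?_⟩
  rw [ValueDistribution.characteristic_pow_top hFm, nsmul_eq_mul]
  simpa using! hk.const_mul_left (n : ℝ)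

lemma IsMeromorphicOfFiniteOrder.zpow {F : ℂ → ℂ} (hF : IsMeromorphicOfFiniteOrder F) (n : ℤ) :
    IsMeromorphicOfFiniteOrder (F ^ n) := by
  cases n with
  | ofNat n => simpa using hF.pow n
  | negSucc n => simpa [zpow_negSucc] using (hF.pow (n + 1)).inv

lemma isMeromorphicOfFiniteOrder_of_norm_le {F : ℂ → ℂ} (hF : Differentiable ℂ F) {C : ℝ}
    (hC : 0 ≤ C) {k : ℕ} (hb : ∀ z, ‖F z‖ ≤ Real.exp (C * (1 + ‖z‖) ^ k)) :
    IsMeromorphicOfFiniteOrder F := by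
  have han : AnalyticOnNhd ℂ F Set.univ := fun z _ ↦ hF.analyticAt z
  have hmer : Meromorphic F := fun z ↦ (hF.analyticAt z).meromorphicAt
  refine ⟨hmer, k, Asymptotics.IsBigO.add ?_ ?_⟩
  · refine Asymptotics.IsBigO.of_bound (C * 2 ^ k) ?_
    filter_upwards [eventually_ge_atTop 1] with r hr
    rw [Real.norm_of_nonneg (ValueDistribution.proximity_nonneg r),
      Real.norm_of_nonneg (by positivity), ValueDistribution.proximity_top]
    refine Real.circleAverage_mono_on_of_le_circle
      (MeromorphicOn.circleIntegrable_posLog_norm fun z _ ↦ hmer z) ?_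
    intro z hz
    have hz' : ‖z‖ = r := by simpa [abs_of_nonneg (zero_le_one.trans hr)] using hz
    refine (Real.posLog_le_posLog (norm_nonneg _) (hb z)).trans ?_
    rw [Real.posLog_apply, Real.log_exp, max_eq_right (by positivity), hz', mul_assoc, ← mul_pow]
    gcongr
    linarith
  · have h : ValueDistribution.logCounting F ⊤ =O[atTop] (1 : ℝ → ℝ) := by
      rw [ValueDistribution.logCounting_isBigO_one_iff_analyticOnNhd hmer,
        toMeromorphicNFOn_eq_self.2 han.meromorphicNFOn]
      exact han
    refine h.trans ?_
    simpa using! isBigO_pow_of_le (Nat.zero_le k)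

/-- A zero-free entire function of finite order is the exponential of a polynomial. -/
lemma exists_polynomial_exp_eq {H : ℂ → ℂ} (hH : Differentiable ℂ H) (h0 : ∀ z, H z ≠ 0)
    (hfin : IsMeromorphicOfFiniteOrder H) :
    ∃ Q : Polynomial ℂ, ∀ z, H z = Complex.exp (Q.eval z) := by
  obtain ⟨h, hd, hh⟩ := exists_differentiable_exp_eq hH h0
  obtain ⟨-, k, hk⟩ := hfin
  obtain ⟨Q, hQ⟩ := exists_polynomial_of_isBigO_circleAverage hd (K := k) (by
    have hprox : ValueDistribution.proximity H ⊤ =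
        Real.circleAverage (fun z ↦ max (h z).re 0) 0 := by
      rw [ValueDistribution.proximity_top]
      congr 1
      ext z
      rw [hh, Complex.norm_exp, Real.posLog_apply, Real.log_exp, max_comm]
    rw [← hprox]
    refine Asymptotics.IsBigO.trans (Asymptotics.IsBigO.of_bound 1 ?_) hk
    filter_upwards [eventually_ge_atTop 1] with r hr
    rw [one_mul, Real.norm_of_nonneg (ValueDistribution.proximity_nonneg r),
      Real.norm_of_nonneg (ValueDistribution.characteristic_nonneg hr)]
    exact le_add_of_nonneg_right (ValueDistribution.logCounting_nonneg hr))
  exact ⟨Q, fun z ↦ by rw [hh, hQ]⟩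

/-! ### The divisor -/

variable {f : ℂ → ℂ}

lemma summable_of_one_le_convergenceExponent (hd : 1 ≤ convergenceExponent f) :
    Summable fun ρ : {ρ : ℂ // ρ ≠ 0} ↦
      |(mult f ρ : ℝ)| / ‖(ρ : ℂ)‖ ^ convergenceExponent f := by
  -- the infimum of the empty set is `0`
  refine Nat.sInf_mem (s := {k : ℕ | Summable fun ρ : {ρ : ℂ // ρ ≠ 0} ↦
    |(mult f ρ : ℝ)| / ‖(ρ : ℂ)‖ ^ k}) ?_
  by_contra hne
  rw [Set.not_nonempty_iff_eq_empty] at hne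
  rw [convergenceExponent, hne, Nat.sInf_empty] at hd
  omega

lemma one_add_sub_convergenceExponent (hd : 1 ≤ convergenceExponent f) :
    convergenceExponent f - 1 + 1 = convergenceExponent f := by omega

lemma summable_mult_div (hd : 1 ≤ convergenceExponent f) (τ : ℂ) :
    Summable fun ρ : {ρ : ℂ // ρ ≠ τ} ↦
      |(mult f ρ : ℝ)| / ‖(ρ : ℂ) - τ‖ ^ (convergenceExponent f - 1 + 1) := by
  rw [one_add_sub_convergenceExponent hd]
  set d := convergenceExponent f
  have h0 := summable_of_one_le_convergenceExponent hd
  have hfin : {ρ : ℂ | ¬(mult f ρ ≠ 0 → 2 * ‖τ‖ ≤ ‖ρ‖)}.Finite := by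
    have h1 : {ρ : {ρ : ℂ // ρ ≠ 0} | ¬(mult f ρ ≠ 0 → 2 * ‖τ‖ ≤ ‖(ρ : ℂ)‖)}.Finite :=
      eventually_le_norm_of_summable (fun ρ ↦ ρ.2) h0 (2 * ‖τ‖)
    refine ((h1.image Subtype.val).union (Set.finite_singleton 0)).subset fun ρ hρ ↦ ?_
    by_cases h : ρ = 0
    · exact Or.inr h
    · exact Or.inl ⟨⟨ρ, h⟩, hρ, rfl⟩
  have h1 : Summable fun ρ : ℂ ↦ |(mult f ρ : ℝ)| / ‖ρ‖ ^ d := by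
    refine (Subtype.val_injective.summable_iff (f := fun ρ : ℂ ↦ |(mult f ρ : ℝ)| / ‖ρ‖ ^ d)
      fun ρ hρ ↦ ?_).1 h0
    have : ρ = 0 := by simpa using hρ
    simp [this, show d ≠ 0 by omega]
  refine Summable.comp_injective (i := Subtype.val)
    (f := fun ρ : ℂ ↦ |(mult f ρ : ℝ)| / ‖ρ - τ‖ ^ d) ?_ Subtype.val_injective
  refine Summable.of_norm_bounded_eventually (h1.mul_left (2 ^ d)) ?_
  filter_upwards [hfin.compl_mem_cofinite, (Set.finite_singleton (0 : ℂ)).compl_mem_cofinite]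
    with ρ hρ hρ0
  rw [Real.norm_of_nonneg (by positivity)]
  by_cases hm : mult f ρ = 0
  · simp [hm]
  have h2 : 2 * ‖τ‖ ≤ ‖ρ‖ := not_not.1 hρ hm
  have h3 : 0 < ‖ρ‖ := norm_pos_iff.2 hρ0
  have h4 : ‖ρ‖ / 2 ≤ ‖ρ - τ‖ := by
    have := norm_sub_norm_le ρ τ
    linarith
  calc |(mult f ρ : ℝ)| / ‖ρ - τ‖ ^ d ≤ |(mult f ρ : ℝ)| / (‖ρ‖ / 2) ^ d := by gcongr
    _ = _ := by rw [div_pow]; field_simp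

lemma meromorphicOrderAt_ne_top (hf : Meromorphic f) (hd : 1 ≤ convergenceExponent f) (z : ℂ) :
    meromorphicOrderAt f z ≠ ⊤ := by
  intro hz
  have hall : ∀ ρ, mult f ρ = 0 := by
    intro ρ
    have : meromorphicOrderAt f ρ = ⊤ := by
      by_contra h
      exact hf.meromorphicOn.meromorphicOrderAt_ne_top_of_isPreconnected
        isPreconnected_univ (Set.mem_univ ρ) (Set.mem_univ z) h hz
    simp [mult, hf.meromorphicOn, this]
  have : convergenceExponent f = 0 := by
    rw [convergenceExponent, Nat.sInf_eq_zero]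
    left
    simp only [Set.mem_ofPred_eq, hall]
    simp
  omega

lemma meromorphicOrderAt_eq_mult (hf : Meromorphic f) (hd : 1 ≤ convergenceExponent f) (z : ℂ) :
    meromorphicOrderAt f z = mult f z := by
  rw [mult, MeromorphicOn.divisor_apply hf.meromorphicOn (Set.mem_univ z),
    WithTop.coe_untop₀_of_ne_top (meromorphicOrderAt_ne_top hf hd z)]

lemma eventually_mult_eq_zero (f : ℂ → ℂ) : ∀ᶠ s in codiscrete ℂ, mult f s = 0 :=
  (MeromorphicOn.divisor f Set.univ).eq_zero_codiscreteWithin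

end

section

variable {f : ℂ → ℂ}

/-! ### Hadamard factorization -/

/-- The canonical product over the zeros of `f` other than `τ`, with origin `τ`. -/
noncomputable def zeroProduct (f : ℂ → ℂ) (τ s : ℂ) : ℂ :=
  canonicalProduct (convergenceExponent f - 1) (fun ρ : {ρ : ℂ // ρ ≠ τ} ↦ (ρ : ℂ) - τ)
    (fun ρ ↦ (mult f ρ).toNat) (s - τ)

/-- The canonical product over the poles of `f` other than `τ`, with origin `τ`. -/
noncomputable def poleProduct (f : ℂ → ℂ) (τ s : ℂ) : ℂ :=
  canonicalProduct (convergenceExponent f - 1) (fun ρ : {ρ : ℂ // ρ ≠ τ} ↦ (ρ : ℂ) - τ)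
    (fun ρ ↦ (-mult f ρ).toNat) (s - τ)

lemma sub_ne_zero_of_index {τ : ℂ} (ρ : {ρ : ℂ // ρ ≠ τ}) : (ρ : ℂ) - τ ≠ 0 := sub_ne_zero.2 ρ.2

lemma injective_sub_index (τ : ℂ) :
    Function.Injective fun ρ : {ρ : ℂ // ρ ≠ τ} ↦ (ρ : ℂ) - τ := fun a b h ↦
  Subtype.ext (by simpa using h)

section Divisor

variable (hd : 1 ≤ convergenceExponent f) (τ : ℂ)
include hd

lemma summable_toNat_mult_div : Summable fun ρ : {ρ : ℂ // ρ ≠ τ} ↦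
    ((mult f ρ).toNat : ℝ) / ‖(ρ : ℂ) - τ‖ ^ (convergenceExponent f - 1 + 1) := by
  refine (summable_mult_div hd τ).of_nonneg_of_le (fun ρ ↦ by positivity) fun ρ ↦ ?_
  gcongr
  have h : ((mult f ρ).toNat : ℤ) ≤ |mult f ρ| := by
    rw [Int.toNat_eq_max]; exact max_le (le_abs_self _) (abs_nonneg _)
  exact_mod_cast h

lemma summable_toNat_neg_mult_div : Summable fun ρ : {ρ : ℂ // ρ ≠ τ} ↦
    ((-mult f ρ).toNat : ℝ) / ‖(ρ : ℂ) - τ‖ ^ (convergenceExponent f - 1 + 1) := by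
  refine (summable_mult_div hd τ).of_nonneg_of_le (fun ρ ↦ by positivity) fun ρ ↦ ?_
  gcongr
  have h : ((-mult f ρ).toNat : ℤ) ≤ |mult f ρ| := by
    rw [Int.toNat_eq_max]; exact max_le (neg_le_abs _) (abs_nonneg _)
  exact_mod_cast h

lemma differentiable_zeroProduct : Differentiable ℂ (zeroProduct f τ) :=
  (differentiable_canonicalProduct sub_ne_zero_of_index (summable_toNat_mult_div hd τ)).comp
    (differentiable_id.sub_const τ)

lemma differentiable_poleProduct : Differentiable ℂ (poleProduct f τ) :=
  (differentiable_canonicalProduct sub_ne_zero_of_index (summable_toNat_neg_mult_div hd τ)).comp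
    (differentiable_id.sub_const τ)

lemma meromorphicOrderAt_zeroProduct (z : ℂ) :
    meromorphicOrderAt (zeroProduct f τ) z = if z = τ then 0 else ((mult f z).toNat : ℤ) := by
  have h := meromorphicOrderAt_comp_sub_const_eq_meromorphicOrderAt (x := z) (c := τ)
    (f := canonicalProduct (convergenceExponent f - 1) (fun ρ : {ρ : ℂ // ρ ≠ τ} ↦ (ρ : ℂ) - τ)
    (fun ρ ↦ (mult f ρ).toNat))
  refine Eq.trans h ?_
  split_ifs with hz
  · refine meromorphicOrderAt_canonicalProduct_eq_zero sub_ne_zero_of_index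
      (summable_toNat_mult_div hd τ) fun ρ _ h ↦ ρ.2 ?_
    rw [hz, sub_self] at h
    exact sub_eq_zero.1 h.symm
  · exact meromorphicOrderAt_canonicalProduct sub_ne_zero_of_index
      (summable_toNat_mult_div hd τ) (injective_sub_index τ) ⟨z, hz⟩

lemma meromorphicOrderAt_poleProduct (z : ℂ) :
    meromorphicOrderAt (poleProduct f τ) z = if z = τ then 0 else ((-mult f z).toNat : ℤ) := by
  have h := meromorphicOrderAt_comp_sub_const_eq_meromorphicOrderAt (x := z) (c := τ)
    (f := canonicalProduct (convergenceExponent f - 1) (fun ρ : {ρ : ℂ // ρ ≠ τ} ↦ (ρ : ℂ) - τ)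
    (fun ρ ↦ (-mult f ρ).toNat))
  refine Eq.trans h ?_
  split_ifs with hz
  · refine meromorphicOrderAt_canonicalProduct_eq_zero sub_ne_zero_of_index
      (summable_toNat_neg_mult_div hd τ) fun ρ _ h ↦ ρ.2 ?_
    rw [hz, sub_self] at h
    exact sub_eq_zero.1 h.symm
  · exact meromorphicOrderAt_canonicalProduct sub_ne_zero_of_index
      (summable_toNat_neg_mult_div hd τ) (injective_sub_index τ) ⟨z, hz⟩

variable {τ} {s : ℂ}

omit hd in
lemma sub_ne_sub_of_mult_eq_zero (hs : mult f s = 0) (ρ : {ρ : ℂ // ρ ≠ τ}) (hρ : mult f ρ ≠ 0) :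
    s - τ ≠ ρ - τ := by
  rintro h
  rw [sub_left_inj.1 h] at hs
  exact hρ hs

lemma zeroProduct_ne_zero (hs : mult f s = 0) : zeroProduct f τ s ≠ 0 :=
  canonicalProduct_ne_zero sub_ne_zero_of_index (summable_toNat_mult_div hd τ) fun ρ hρ ↦
    sub_ne_sub_of_mult_eq_zero hs ρ (by rintro h; simp [h] at hρ)

lemma poleProduct_ne_zero (hs : mult f s = 0) : poleProduct f τ s ≠ 0 :=
  canonicalProduct_ne_zero sub_ne_zero_of_index (summable_toNat_neg_mult_div hd τ) fun ρ hρ ↦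
    sub_ne_sub_of_mult_eq_zero hs ρ (by rintro h; simp [h] at hρ)

/-- Off the divisor, the product over the divisor is the quotient of the canonical products over
the zeros and over the poles. -/
lemma hasProd_weierstrassFactor_zpow (hs : mult f s = 0) :
    HasProd (fun ρ : {ρ : ℂ // ρ ≠ τ} ↦
      weierstrassFactor (convergenceExponent f - 1) ((s - τ) / ((ρ : ℂ) - τ)) ^ mult f ρ)
      (zeroProduct f τ s * (poleProduct f τ s)⁻¹) := by
  have h1 := (multipliable_factor sub_ne_zero_of_index (summable_toNat_mult_div hd τ)
    (s - τ)).hasProd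
  have h2 := (multipliable_factor sub_ne_zero_of_index (summable_toNat_neg_mult_div hd τ)
    (s - τ)).hasProd
  have h3 := h1.mul (g := fun ρ : {ρ : ℂ // ρ ≠ τ} ↦
      (weierstrassFactor (convergenceExponent f - 1) ((s - τ) / ((ρ : ℂ) - τ)) ^
        (-mult f ρ).toNat)⁻¹) (b := (poleProduct f τ s)⁻¹) (by
      have := Tendsto.inv₀ h2 (poleProduct_ne_zero hd hs)
      simpa only [HasProd, ← Finset.prod_inv_distrib] using! this)
  refine h3.congr_fun fun ρ ↦ ?_
  rcases le_total 0 (mult f ρ) with h | h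
  · rw [Int.toNat_of_nonpos (by omega : -mult f ρ ≤ 0), pow_zero, inv_one, mul_one,
      ← zpow_natCast, Int.toNat_of_nonneg h]
  · rw [Int.toNat_of_nonpos h, pow_zero, one_mul, ← zpow_natCast,
      Int.toNat_of_nonneg (by omega : 0 ≤ -mult f ρ), zpow_neg, inv_inv]

end Divisor

lemma isMeromorphicOfFiniteOrder_comp_sub {ι : Type*} {m : ℕ} {a : ι → ℂ} {ν : ι → ℕ}
    (ha : ∀ i, a i ≠ 0) (hs : Summable fun i ↦ (ν i : ℝ) / ‖a i‖ ^ (m + 1)) (τ : ℂ) :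
    IsMeromorphicOfFiniteOrder fun s ↦ canonicalProduct m a ν (s - τ) := by
  have hS : 0 ≤ ∑' i, (ν i : ℝ) / ‖a i‖ ^ (m + 1) := tsum_nonneg fun i ↦ by positivity
  refine isMeromorphicOfFiniteOrder_of_norm_le
    ((differentiable_canonicalProduct ha hs).comp (differentiable_id.sub_const τ))
    (C := (Real.exp m + m + 1) * (∑' i, (ν i : ℝ) / ‖a i‖ ^ (m + 1)) * (1 + ‖τ‖) ^ (m + 1))
    (k := m + 1) (by positivity) fun z ↦ ?_
  refine (norm_canonicalProduct_le ha hs _).trans (Real.exp_le_exp.2 ?_)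
  rw [mul_assoc _ ((1 + ‖τ‖) ^ _), ← mul_pow]
  gcongr
  calc ‖z - τ‖ ≤ ‖z‖ + ‖τ‖ := norm_sub_le _ _
    _ ≤ (1 + ‖τ‖) * (1 + ‖z‖) := by nlinarith [norm_nonneg z, norm_nonneg τ]

lemma isMeromorphicOfFiniteOrder_sub_const (τ : ℂ) :
    IsMeromorphicOfFiniteOrder fun s ↦ s - τ := by
  refine isMeromorphicOfFiniteOrder_of_norm_le (differentiable_id.sub_const τ)
    (C := 1 + ‖τ‖) (k := 1) (by positivity) fun z ↦ ?_
  calc ‖z - τ‖ ≤ ‖z‖ + ‖τ‖ := norm_sub_le _ _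
    _ ≤ (1 + ‖τ‖) * (1 + ‖z‖) ^ 1 + 1 := by nlinarith [norm_nonneg z, norm_nonneg τ]
    _ ≤ _ := Real.add_one_le_exp _

/-- **Hadamard factorization**: dividing a function of finite order by the canonical products of its
divisor leaves a zero-free entire function of finite order, the exponential of a polynomial. -/
theorem exists_isHadamardPolynomial (hf : IsMeromorphicOfFiniteOrder f)
    (hd : 1 ≤ convergenceExponent f) (τ : ℂ) : ∃ Q, IsHadamardPolynomial f τ Q := by
  have hA := isMeromorphicOfFiniteOrder_comp_sub sub_ne_zero_of_index
    (summable_toNat_mult_div hd τ) τ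
  have hB := isMeromorphicOfFiniteOrder_comp_sub sub_ne_zero_of_index
    (summable_toNat_neg_mult_div hd τ) τ
  change IsMeromorphicOfFiniteOrder (zeroProduct f τ) at hA
  change IsMeromorphicOfFiniteOrder (poleProduct f τ) at hB
  have hP := (isMeromorphicOfFiniteOrder_sub_const τ).zpow (-mult f τ)
  set P : ℂ → ℂ := (fun s ↦ s - τ) ^ (-mult f τ) with hPdef
  have oP : ∀ z, meromorphicOrderAt P z = if z = τ then ((-mult f τ : ℤ) : WithTop ℤ) else 0 := by
    intro z
    split_ifs with hz
    · rw [hz]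
      exact meromorphicOrderAt_zpow_id_sub_const
    · have h1 : AnalyticAt ℂ (fun s ↦ s - τ) z := by fun_prop
      have h2 : meromorphicOrderAt (fun s ↦ s - τ) z = 0 :=
        h1.meromorphicNFAt.meromorphicOrderAt_eq_zero_iff.2 (sub_ne_zero.2 hz)
      rw [hPdef, meromorphicOrderAt_zpow h1.meromorphicAt, h2, mul_zero]
  have oA := meromorphicOrderAt_zeroProduct hd τ
  have oB := meromorphicOrderAt_poleProduct hd τ
  have of := meromorphicOrderAt_eq_mult hf.1 hd
  have oAinv : ∀ z, meromorphicOrderAt (zeroProduct f τ)⁻¹ z =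
      ((if z = τ then 0 else -((mult f z).toNat : ℤ) : ℤ) : WithTop ℤ) := by
    intro z
    rw [meromorphicOrderAt_inv, oA]
    split_ifs <;> simp
  have oP' : ∀ z, meromorphicOrderAt P z =
      ((if z = τ then -mult f τ else 0 : ℤ) : WithTop ℤ) := by
    intro z
    rw [oP]
    split_ifs <;> simp
  have ofB : ∀ z, meromorphicOrderAt (f * poleProduct f τ) z =
      ((mult f z + if z = τ then 0 else ((-mult f z).toNat : ℤ) : ℤ) : WithTop ℤ) := by
    intro z
    rw [meromorphicOrderAt_mul (hf.1 z) (hB.1 z), of, oB, WithTop.coe_add]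
  have hfB := hf.mul hB (by simp [of]) (by simp [oB])
  have ofBA : ∀ z, meromorphicOrderAt (f * poleProduct f τ * (zeroProduct f τ)⁻¹) z =
      ((mult f z + (if z = τ then 0 else ((-mult f z).toNat : ℤ)) +
        (if z = τ then 0 else -((mult f z).toNat : ℤ)) : ℤ) : WithTop ℤ) := by
    intro z
    rw [meromorphicOrderAt_mul (hfB.1 z) (hA.inv.1 z), ofB, oAinv, ← WithTop.coe_add]
  have hfBA := hfB.mul hA.inv (fun z ↦ by simp [ofB]) (fun z ↦ by simp [oAinv])
  set H := f * poleProduct f τ * (zeroProduct f τ)⁻¹ * P with hH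
  have hHfin : IsMeromorphicOfFiniteOrder H :=
    hfBA.mul hP (fun z ↦ by simp [ofBA]) (fun z ↦ by simp [oP'])
  have oH : ∀ z, meromorphicOrderAt H z = 0 := by
    intro z
    rw [hH, meromorphicOrderAt_mul (hfBA.1 z) (hP.1 z), ofBA, oP', ← WithTop.coe_add]
    norm_cast
    split_ifs with h
    · subst h; omega
    · omega
  -- All orders of `H` vanish, so its normal form is entire and zero-free.
  set H' := toMeromorphicNFOn H Set.univ
  have hNF := meromorphicNFOn_toMeromorphicNFOn H Set.univ
  have oH' : ∀ z, meromorphicOrderAt H' z = 0 := fun z ↦ by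
    rw [meromorphicOrderAt_toMeromorphicNFOn hHfin.1.meromorphicOn (Set.mem_univ z), oH]
  have hHH' : H =ᶠ[codiscrete ℂ] H' := toMeromorphicNFOn_eqOn_codiscrete hHfin.1.meromorphicOn
  have hH'd : Differentiable ℂ H' := fun z ↦
    ((hNF (Set.mem_univ z)).meromorphicOrderAt_nonneg_iff_analyticAt.1
      (oH' z).ge).differentiableAt
  have hH'0 : ∀ z, H' z ≠ 0 := fun z ↦
    (hNF (Set.mem_univ z)).meromorphicOrderAt_eq_zero_iff.1 (oH' z)
  have hH'fin : IsMeromorphicOfFiniteOrder H' := by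
    obtain ⟨-, k, hk⟩ := hHfin
    refine ⟨fun z ↦ (hH'd.analyticAt z).meromorphicAt, k, hk.congr' ?_ EventuallyEq.rfl⟩
    filter_upwards [eventually_ne_atTop 0] with r hr
    exact ValueDistribution.characteristic_congr_codiscrete hHH' hr
  obtain ⟨Q, hQ⟩ := exists_polynomial_exp_eq hH'd hH'0 hH'fin
  refine ⟨Q, ?_⟩
  have hτ : ∀ᶠ s in codiscrete ℂ, s ≠ τ := (Set.finite_singleton τ).compl_mem_codiscrete
  filter_upwards [eventually_mult_eq_zero f, hHH', hτ] with s hs hsH hsτ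
  have hprod := hasProd_weierstrassFactor_zpow hd (τ := τ) hs
  refine ⟨hprod.multipliable, ?_⟩
  have h0 := zeroProduct_ne_zero hd (τ := τ) hs
  have h1 := poleProduct_ne_zero hd (τ := τ) hs
  have h2 : (s - τ) ^ mult f τ ≠ 0 := zpow_ne_zero _ (sub_ne_zero.2 hsτ)
  rw [hprod.tprod_eq, ← hQ, ← hsH]
  simp only [hH, hPdef, Pi.mul_apply, Pi.inv_apply, Pi.pow_apply, zpow_neg]
  field_simp

/-! ### The logarithmic derivative -/

section LogDeriv

variable {τ : ℂ} {Q : Polynomial ℂ}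

/-- The term of index `ρ` in the partial fraction expansion of `f' / f` with origin `τ`. -/
noncomputable def fractionTerm (f : ℂ → ℂ) (τ s : ℂ) (ρ : {ρ : ℂ // ρ ≠ τ}) : ℂ :=
  mult f ρ * ((s - τ) ^ (convergenceExponent f - 1) /
    ((s - ρ) * ((ρ : ℂ) - τ) ^ (convergenceExponent f - 1)))

lemma logDeriv_zeroProduct_sub_logDeriv_poleProduct (hd : 1 ≤ convergenceExponent f) {s : ℂ}
    (hs : mult f s = 0) :
    logDeriv (zeroProduct f τ) s - logDeriv (poleProduct f τ) s =
      ∑' ρ, fractionTerm f τ s ρ := by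
  have hsub : DifferentiableAt ℂ (fun s ↦ s - τ) s := by fun_prop
  have hz : ∀ (ν : {ρ : ℂ // ρ ≠ τ} → ℕ), (∀ ρ, ν ρ ≠ 0 → mult f ρ ≠ 0) →
      (Summable fun ρ ↦ (ν ρ : ℝ) / ‖(ρ : ℂ) - τ‖ ^ (convergenceExponent f - 1 + 1)) →
      HasSum (fun ρ : {ρ : ℂ // ρ ≠ τ} ↦ (ν ρ : ℂ) * ((s - τ) ^ (convergenceExponent f - 1) /
        ((s - ρ) * ((ρ : ℂ) - τ) ^ (convergenceExponent f - 1))))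
      (logDeriv (fun s ↦ canonicalProduct (convergenceExponent f - 1)
        (fun ρ : {ρ : ℂ // ρ ≠ τ} ↦ (ρ : ℂ) - τ) ν (s - τ)) s) := by
    intro ν hν hsum
    have h1 := logDeriv_comp (f := canonicalProduct (convergenceExponent f - 1)
        (fun ρ : {ρ : ℂ // ρ ≠ τ} ↦ (ρ : ℂ) - τ) ν) (g := fun s ↦ s - τ) (x := s)
        (differentiable_canonicalProduct sub_ne_zero_of_index hsum _) hsub
    rw [logDeriv_canonicalProduct sub_ne_zero_of_index hsum fun ρ hρ ↦
      sub_ne_sub_of_mult_eq_zero hs ρ (hν ρ hρ)] at h1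
    have h2 := (summable_norm_partialFraction (k := fun ρ ↦ (ν ρ : ℤ)) sub_ne_zero_of_index
      (by simpa using hsum) (s - τ)).of_norm
    simp only [sub_sub_sub_cancel_right, deriv_sub_const_fun, deriv_id'', mul_one,
      Int.cast_natCast] at h1 h2
    have h3 := h2.hasSum
    rw [← h1] at h3
    exact h3
  have h1 := hz _ (fun ρ h h' ↦ h (by simp [h'])) (summable_toNat_mult_div hd τ)
  have h2 := hz _ (fun ρ h h' ↦ h (by simp [h'])) (summable_toNat_neg_mult_div hd τ)
  refine (h1.sub h2).tsum_eq.symm.trans (tsum_congr fun ρ ↦ ?_)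
  rw [← sub_mul, fractionTerm]
  congr 1
  exact_mod_cast Int.toNat_sub_toNat_neg (mult f ρ)

/-- The logarithmic derivative of a function with Hadamard polynomial `Q` is
`Q' + n_τ / (s - τ) + ∑ n_ρ (s - τ) ^ m / ((s - ρ) (ρ - τ) ^ m)` off the divisor. -/
theorem analyticAt_logDerivative (hf : Meromorphic f) (hd : 1 ≤ convergenceExponent f)
    (hQ : IsHadamardPolynomial f τ Q) {s : ℂ} (hs : mult f s = 0) :
    AnalyticAt ℂ (logDerivative f) s ∧
      logDerivative f s = Q.derivative.eval s + mult f τ / (s - τ) +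
        ∑' ρ, fractionTerm f τ s ρ := by
  set G : ℂ → ℂ := fun s ↦ (s - τ) ^ mult f τ * Complex.exp (Q.eval s) *
    (zeroProduct f τ s / poleProduct f τ s) with hG
  have hfG : f =ᶠ[codiscrete ℂ] G := by
    filter_upwards [hQ, eventually_mult_eq_zero f] with x hx hx0
    rw [hx.2, (hasProd_weierstrassFactor_zpow hd hx0).tprod_eq, ← div_eq_mul_inv]
  have hfGs : f =ᶠ[𝓝[≠] s] G :=
    hfG.filter_mono (by
      intro t ht
      have := mem_codiscrete.1 ht s
      rwa [disjoint_principal_right, compl_compl] at this)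
  have hτ : mult f τ ≠ 0 → s - τ ≠ 0 := fun h h' ↦ h (by rw [← sub_eq_zero.1 h', hs])
  have hA0 := zeroProduct_ne_zero hd (τ := τ) hs
  have hB0 := poleProduct_ne_zero hd (τ := τ) hs
  have hA := (differentiable_zeroProduct hd τ).analyticAt s
  have hB := (differentiable_poleProduct hd τ).analyticAt s
  have hp0 : (s - τ) ^ mult f τ ≠ 0 := by
    by_cases h : mult f τ = 0
    · simp [h]
    · exact zpow_ne_zero _ (hτ h)
  have hpan : AnalyticAt ℂ (fun s ↦ (s - τ) ^ mult f τ) s := by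
    by_cases h : mult f τ = 0
    · simp only [h, zpow_zero]; exact analyticAt_const
    · exact (analyticAt_id.sub analyticAt_const).zpow (hτ h)
  have hexp : AnalyticAt ℂ (fun s ↦ Complex.exp (Q.eval s)) s :=
    (Q.differentiable.cexp).analyticAt s
  have hGan : AnalyticAt ℂ G s := (hpan.mul hexp).mul (hA.div hB hB0)
  have hG0 : G s ≠ 0 := mul_ne_zero (mul_ne_zero hp0 (Complex.exp_ne_zero _)) (div_ne_zero hA0 hB0)
  have hLG : AnalyticAt ℂ (logDeriv G) s := hGan.deriv.div hGan hG0
  have hLm : MeromorphicOn (logDeriv f) Set.univ := fun z _ ↦ (hf z).deriv.div (hf z)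
  have heq : logDerivative f =ᶠ[𝓝 s] logDeriv G := by
    refine (MeromorphicNFAt.eventuallyEq_nhdsNE_iff_eventuallyEq_nhds
      (meromorphicNFOn_toMeromorphicNFOn _ _ (Set.mem_univ s)) hLG.meromorphicNFAt).1 ?_
    exact (hLm.toMeromorphicNFOn_eq_self_on_nhdsNE (Set.mem_univ s)).trans
      (logDeriv_congr_nhdsNE hfGs)
  refine ⟨hLG.congr heq.symm, ?_⟩
  rw [heq.eq_of_nhds, hG,
    logDeriv_mul (f := fun s ↦ (s - τ) ^ mult f τ * Complex.exp (Q.eval s))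
      (g := fun s ↦ zeroProduct f τ s / poleProduct f τ s) s
      (mul_ne_zero hp0 (Complex.exp_ne_zero _)) (div_ne_zero hA0 hB0)
      (hpan.mul hexp).differentiableAt (hA.div hB hB0).differentiableAt,
    logDeriv_mul (g := fun s ↦ Complex.exp (Q.eval s)) s hp0 (Complex.exp_ne_zero _)
      hpan.differentiableAt hexp.differentiableAt,
    logDeriv_div s hA0 hB0 hA.differentiableAt hB.differentiableAt,
    logDeriv_zeroProduct_sub_logDeriv_poleProduct hd hs,
    logDeriv_fun_zpow (by fun_prop)]
  have h1 : logDeriv (fun s ↦ s - τ) s = 1 / (s - τ) := by simp [logDeriv_apply]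
  have h2 : logDeriv (fun s ↦ Complex.exp (Q.eval s)) s = Q.derivative.eval s := by
    rw [logDeriv_apply, ((Q.hasDerivAt s).cexp).deriv,
      mul_div_cancel_left₀ _ (Complex.exp_ne_zero _)]
  rw [h1, h2]
  ring

/-- The logarithmic derivative is continuous at no point of the divisor, as `f' / f` has a simple
pole at each of them. -/
lemma mult_eq_zero_of_continuousAt_logDerivative (hf : Meromorphic f)
    (hd : 1 ≤ convergenceExponent f) {s : ℂ} (hs : ContinuousAt (logDerivative f) s) :
    mult f s = 0 := by
  by_contra hne
  have hLm : MeromorphicOn (logDeriv f) Set.univ := fun z _ ↦ (hf z).deriv.div (hf z)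
  have h1 := meromorphicOrderAt_logDeriv_eq_neg_one (hf s)
    (by rw [meromorphicOrderAt_eq_mult hf hd]; exact_mod_cast hne)
    (meromorphicOrderAt_ne_top hf hd s)
  rw [← meromorphicOrderAt_toMeromorphicNFOn hLm (Set.mem_univ s)] at h1
  have h2 := (tendsto_nhds_iff_meromorphicOrderAt_nonneg
    (meromorphicNFOn_toMeromorphicNFOn _ _ (Set.mem_univ s)).meromorphicAt).1
    ⟨_, (hs.tendsto.mono_left nhdsWithin_le_nhds : Tendsto (logDerivative f) (𝓝[≠] s) _)⟩
  rw [h1] at h2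
  exact absurd h2 (by decide)

end LogDeriv

end

section

variable {f : ℂ → ℂ}

/-! ### Growth of the logarithmic derivative in right half-planes -/

lemma norm_polynomial_eval_le (Q : Polynomial ℂ) (s : ℂ) :
    ‖Q.eval s‖ ≤ (∑ i ∈ Finset.range (Q.natDegree + 1), ‖Q.coeff i‖) *
      (1 + ‖s‖) ^ Q.natDegree := by
  rw [Polynomial.eval_eq_sum_range, Finset.sum_mul]
  refine norm_sum_le_of_le _ fun i hi ↦ ?_
  rw [norm_mul, norm_pow]
  gcongr
  calc ‖s‖ ^ i ≤ (1 + ‖s‖) ^ i := by gcongr; linarith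
    _ ≤ _ := pow_le_pow_right₀ (by linarith [norm_nonneg s])
      (Nat.lt_succ_iff.1 (Finset.mem_range.1 hi))

/-- A bound by the summable weights `|n_ρ| / |ρ - τ| ^ d`, uniform at distance `δ` from the divisor,
from `|ρ - τ| ≤ |s - ρ| + |s - τ|`. -/
lemma norm_fractionTerm_le {τ s : ℂ} {δ : ℝ} (hδ : 0 < δ) (ρ : {ρ : ℂ // ρ ≠ τ})
    (h : mult f ρ ≠ 0 → δ ≤ ‖s - ρ‖) :
    ‖fractionTerm f τ s ρ‖ ≤ |(mult f ρ : ℝ)| / ‖(ρ : ℂ) - τ‖ ^ (convergenceExponent f - 1 + 1) *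
      (‖s - τ‖ ^ (convergenceExponent f - 1) * (1 + ‖s - τ‖ / δ)) := by
  set m := convergenceExponent f - 1
  by_cases hρ : mult f ρ = 0
  · simp [fractionTerm, hρ]
  have h1 := h hρ
  have h2 : 0 < ‖s - ρ‖ := hδ.trans_le h1
  have h3 : 0 < ‖(ρ : ℂ) - τ‖ := norm_pos_iff.2 (sub_ne_zero_of_index ρ)
  have h4 : ‖(ρ : ℂ) - τ‖ / ‖s - ρ‖ ≤ 1 + ‖s - τ‖ / δ := by
    have h5 : ‖(ρ : ℂ) - τ‖ ≤ ‖s - ρ‖ + ‖s - τ‖ := by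
      have := norm_sub_le (s - τ) (s - ρ)
      rw [sub_sub_sub_cancel_left] at this
      linarith
    calc ‖(ρ : ℂ) - τ‖ / ‖s - ρ‖ ≤ (‖s - ρ‖ + ‖s - τ‖) / ‖s - ρ‖ := by gcongr
      _ = 1 + ‖s - τ‖ / ‖s - ρ‖ := by field_simp
      _ ≤ _ := by gcongr
  simp only [fractionTerm, norm_mul, norm_div, norm_pow, Complex.norm_intCast]
  calc |(mult f ρ : ℝ)| * (‖s - τ‖ ^ m / (‖s - ρ‖ * ‖(ρ : ℂ) - τ‖ ^ m))
      = |(mult f ρ : ℝ)| / ‖(ρ : ℂ) - τ‖ ^ (m + 1) *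
        (‖s - τ‖ ^ m * (‖(ρ : ℂ) - τ‖ / ‖s - ρ‖)) := by field_simp; ring
    _ ≤ _ := by gcongr

lemma norm_tsum_fractionTerm_le (hd : 1 ≤ convergenceExponent f) {τ s : ℂ} {δ : ℝ} (hδ : 0 < δ)
    (h : ∀ ρ, mult f ρ ≠ 0 → δ ≤ ‖s - ρ‖) :
    ‖∑' ρ, fractionTerm f τ s ρ‖ ≤
      (∑' ρ : {ρ : ℂ // ρ ≠ τ},
        |(mult f ρ : ℝ)| / ‖(ρ : ℂ) - τ‖ ^ (convergenceExponent f - 1 + 1)) *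
      (‖s - τ‖ ^ (convergenceExponent f - 1) * (1 + ‖s - τ‖ / δ)) := by
  rw [← tsum_mul_right]
  exact tsum_of_norm_bounded ((summable_mult_div hd τ).mul_right _).hasSum
    fun ρ ↦ norm_fractionTerm_le hδ ρ (h ρ)

lemma mult_eq_zero_of_lt {σ₁ : ℝ} (hleft : ∀ ρ : ℂ, mult f ρ ≠ 0 → ρ.re ≤ σ₁) {s : ℂ}
    (hs : σ₁ < s.re) : mult f s = 0 := by
  by_contra h
  exact absurd (hleft s h) (not_le.2 hs)

/-- Away from the divisor the partial fraction expansion grows at most like a power `|s| ^ N`; two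
further powers in the denominator give an admissible pair. -/
theorem exists_laplaceAdmissible (hf : IsMeromorphicOfFiniteOrder f)
    (hd : 1 ≤ convergenceExponent f) (hleft : HasLeftDivisor f) :
    ∃ (c : ℝ) (m₀ : ℕ), LaplaceAdmissible (logDerivative f) c m₀ := by
  obtain ⟨σ₁, hσ₁⟩ := hleft
  obtain ⟨Q, hQ⟩ := exists_isHadamardPolynomial hf hd 0
  set m := convergenceExponent f - 1
  set B := ∑ i ∈ Finset.range (Q.derivative.natDegree + 1), ‖Q.derivative.coeff i‖
  set S := ∑' ρ : {ρ : ℂ // ρ ≠ 0}, |(mult f ρ : ℝ)| / ‖(ρ : ℂ) - 0‖ ^ (m + 1)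
  have hB : 0 ≤ B := by positivity
  have hS : 0 ≤ S := tsum_nonneg fun ρ ↦ by positivity
  set N := Q.derivative.natDegree + m + 1
  set C := B * 2 ^ N + |(mult f 0 : ℝ)| + S * 2
  refine ⟨|σ₁| + 2, N + 2, |σ₁| + 1, C, by positivity, by linarith, ?_, ?_⟩
  · intro s hs
    have hs' : σ₁ < s.re := by
      have : |σ₁| + 1 < s.re := hs
      linarith [le_abs_self σ₁]
    exact (analyticAt_logDerivative hf.1 hd hQ
      (mult_eq_zero_of_lt hσ₁ hs')).1.differentiableAt.differentiableWithinAt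
  · intro s hs
    have hs' : σ₁ + 1 ≤ s.re := by linarith [le_abs_self σ₁]
    have h1 : 1 ≤ ‖s‖ := by
      have := (le_abs_self _).trans (Complex.abs_re_le_norm s)
      linarith [abs_nonneg σ₁]
    have hdist : ∀ ρ, mult f ρ ≠ 0 → 1 ≤ ‖s - ρ‖ := by
      intro ρ hρ
      have h2 := hσ₁ ρ hρ
      have h3 := (le_abs_self _).trans (Complex.abs_re_le_norm (s - ρ))
      rw [Complex.sub_re] at h3
      linarith
    rw [(analyticAt_logDerivative hf.1 hd hQ (mult_eq_zero_of_lt hσ₁ (by linarith))).2]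
    have hb1 : ‖Q.derivative.eval s‖ ≤ B * 2 ^ N * ‖s‖ ^ N := by
      refine (norm_polynomial_eval_le _ s).trans ?_
      rw [mul_assoc, ← mul_pow]
      gcongr
      calc (1 + ‖s‖) ^ Q.derivative.natDegree ≤ (2 * ‖s‖) ^ Q.derivative.natDegree := by
            gcongr; linarith
        _ ≤ _ := pow_le_pow_right₀ (by linarith) (by omega)
    have hb2 : ‖(mult f 0 : ℂ) / (s - 0)‖ ≤ |(mult f 0 : ℝ)| * ‖s‖ ^ N := by
      rw [norm_div, Complex.norm_intCast, sub_zero]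
      calc |(mult f 0 : ℝ)| / ‖s‖ ≤ |(mult f 0 : ℝ)| := div_le_self (abs_nonneg _) h1
        _ ≤ _ := le_mul_of_one_le_right (abs_nonneg _) (one_le_pow₀ h1)
    have hb3 : ‖∑' ρ, fractionTerm f 0 s ρ‖ ≤ S * 2 * ‖s‖ ^ N := by
      refine (norm_tsum_fractionTerm_le hd one_pos hdist).trans ?_
      rw [mul_assoc, sub_zero, div_one]
      refine mul_le_mul_of_nonneg_left ?_ hS
      calc ‖s‖ ^ m * (1 + ‖s‖) ≤ ‖s‖ ^ m * (2 * ‖s‖) := by gcongr; linarith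
        _ = 2 * ‖s‖ ^ (m + 1) := by ring
        _ ≤ _ := by
          gcongr
          omega
    have hb := norm_add₃_le (a := Q.derivative.eval s) (b := (mult f 0 : ℂ) / (s - 0))
      (c := ∑' ρ, fractionTerm f 0 s ρ)
    rw [div_le_div_iff₀ (by positivity) (by positivity), pow_add, ← mul_assoc]
    gcongr
    calc _ ≤ _ := hb
      _ ≤ B * 2 ^ N * ‖s‖ ^ N + |(mult f 0 : ℝ)| * ‖s‖ ^ N + S * 2 * ‖s‖ ^ N := by gcongr
      _ = C * ‖s‖ ^ N := by ring

/-! ### Comparison of Hadamard polynomials with different origins -/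

/-- A complex polynomial that is `o(x ^ m)` along the positive real axis has degree less than
`m`. -/
lemma degree_lt_of_tendsto (R : Polynomial ℂ) (m : ℕ)
    (h : Tendsto (fun x : ℝ ↦ R.eval (x : ℂ) / (x : ℂ) ^ m) atTop (𝓝 0)) : R.degree < m := by
  by_contra! hdeg
  have hR : R ≠ 0 := by
    rintro rfl
    simp at hdeg
  have hn : m ≤ R.natDegree := by
    rw [Polynomial.degree_eq_natDegree hR] at hdeg
    exact_mod_cast hdeg
  have hinv : Tendsto (fun x : ℝ ↦ ((x : ℂ))⁻¹) atTop (𝓝 0) := by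
    have := (Complex.continuous_ofReal.tendsto 0).comp tendsto_inv_atTop_zero
    simpa [Function.comp_def] using this
  have h1 : Tendsto (fun x : ℝ ↦ R.reverse.eval ((x : ℂ)⁻¹)) atTop (𝓝 R.leadingCoeff) := by
    have := (R.reverse.continuous.tendsto 0).comp hinv
    rwa [← Polynomial.coeff_zero_eq_eval_zero, Polynomial.coeff_zero_reverse] at this
  have h2 : Tendsto (fun x : ℝ ↦ R.reverse.eval ((x : ℂ)⁻¹)) atTop (𝓝 0) := by
    have h3 := h.mul (hinv.pow (R.natDegree - m))
    have h4 : Tendsto (fun x : ℝ ↦ R.eval (x : ℂ) / (x : ℂ) ^ m *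
        ((x : ℂ)⁻¹) ^ (R.natDegree - m)) atTop (𝓝 0) := by simpa using h3
    refine h4.congr' ?_
    filter_upwards [eventually_gt_atTop 0] with x hx
    have hx0 : (x : ℂ) ≠ 0 := by exact_mod_cast hx.ne'
    have h5 : R.reverse.eval ((x : ℂ)⁻¹) * (x : ℂ) ^ R.natDegree = R.eval (x : ℂ) := by
      have : Invertible (x : ℂ) := invertibleOfNonzero hx0
      have := Polynomial.eval₂_reverse_mul_pow (RingHom.id ℂ) (x : ℂ) R
      simpa [Polynomial.eval₂_id, invOf_eq_inv] using this
    rw [← h5, inv_pow, div_eq_mul_inv, mul_assoc, mul_assoc, ← mul_inv, ← pow_add,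
      Nat.add_sub_cancel' hn, mul_inv_cancel₀ (pow_ne_zero _ hx0), mul_one]
  exact hR (Polynomial.leadingCoeff_eq_zero.1 (tendsto_nhds_unique h1 h2))

/-- Along the positive real axis the partial fraction series is `o(x ^ m)`: the distance from `x`
to a point `ρ` of a left half-plane is at least `|ρ|` for large `x`, which gives a domination. -/
lemma tendsto_tsum_fractionTerm_div (hd : 1 ≤ convergenceExponent f) {σ₁ : ℝ}
    (hleft : ∀ ρ : ℂ, mult f ρ ≠ 0 → ρ.re ≤ σ₁) (τ : ℂ) :
    Tendsto (fun x : ℝ ↦ (∑' ρ, fractionTerm f τ x ρ) / (x : ℂ) ^ (convergenceExponent f - 1))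
      atTop (𝓝 0) := by
  set m := convergenceExponent f - 1
  have hlarge : ∀ᶠ x : ℝ in atTop, 2 * |σ₁| + 1 + ‖τ‖ ≤ x := eventually_ge_atTop _
  have hratio : ∀ x : ℝ, 2 * |σ₁| + 1 + ‖τ‖ ≤ x → ‖(x : ℂ) - τ‖ ^ m / ‖(x : ℂ)‖ ^ m ≤ 2 ^ m := by
    intro x hx
    have hx0 : 0 < x := by have := norm_nonneg τ; have := abs_nonneg σ₁; linarith
    rw [← div_pow]
    gcongr
    rw [Complex.norm_real, Real.norm_of_nonneg hx0.le, div_le_iff₀ hx0]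
    calc ‖(x : ℂ) - τ‖ ≤ ‖(x : ℂ)‖ + ‖τ‖ := norm_sub_le _ _
      _ ≤ 2 * x := by
        rw [Complex.norm_real, Real.norm_of_nonneg hx0.le]
        linarith [abs_nonneg σ₁]
  have hterm : ∀ (ρ : {ρ : ℂ // ρ ≠ τ}) (x : ℝ), 2 * |σ₁| + 1 + ‖τ‖ ≤ x →
      ‖fractionTerm f τ x ρ / (x : ℂ) ^ m‖ ≤
        |(mult f ρ : ℝ)| * 2 ^ m / ‖(ρ : ℂ) - τ‖ ^ m * ‖(x : ℂ) - ρ‖⁻¹ := by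
    intro ρ x hx
    simp only [fractionTerm, norm_mul, norm_div, norm_pow, Complex.norm_intCast]
    calc |(mult f ρ : ℝ)| * (‖(x : ℂ) - τ‖ ^ m / (‖(x : ℂ) - ρ‖ * ‖(ρ : ℂ) - τ‖ ^ m)) /
          ‖(x : ℂ)‖ ^ m
        = |(mult f ρ : ℝ)| * (‖(x : ℂ) - τ‖ ^ m / ‖(x : ℂ)‖ ^ m) / ‖(ρ : ℂ) - τ‖ ^ m *
            ‖(x : ℂ) - ρ‖⁻¹ := by
          rw [div_mul_eq_div_div, div_eq_mul_inv _ ‖(x : ℂ) - ρ‖]; ring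
      _ ≤ _ := by
          gcongr
          exact hratio x hx
  have h0 : Tendsto (fun x : ℝ ↦ ∑' ρ, fractionTerm f τ x ρ / (x : ℂ) ^ m) atTop
      (𝓝 (∑' _ : {ρ : ℂ // ρ ≠ τ}, (0 : ℂ))) := by
    refine tendsto_tsum_of_dominated_convergence
      ((summable_mult_div hd τ).mul_left (2 ^ m * (1 + ‖τ‖))) (fun ρ ↦ ?_) ?_
    · refine squeeze_zero_norm' (hlarge.mono (hterm ρ)) ?_
      have h1 : Tendsto (fun x : ℝ ↦ ‖(x : ℂ) - ρ‖) atTop atTop := by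
        refine tendsto_atTop_mono (f := fun x : ℝ ↦ x - ‖(ρ : ℂ)‖) (fun x ↦ ?_)
          (tendsto_atTop_add_const_right _ _ tendsto_id)
        have := norm_sub_norm_le (x : ℂ) ρ
        rw [Complex.norm_real] at this
        linarith [Real.le_norm_self x]
      simpa using h1.inv_tendsto_atTop.const_mul _
    · filter_upwards [hlarge] with x hx ρ
      refine (hterm ρ x hx).trans ?_
      by_cases hρ : mult f ρ = 0
      · simp [hρ]
      have hre := hleft ρ hρ
      have h3 : 0 < ‖(ρ : ℂ) - τ‖ := norm_pos_iff.2 (sub_ne_zero_of_index ρ)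
      have hσ := le_abs_self σ₁
      have hσ' := abs_nonneg σ₁
      have hτ := norm_nonneg τ
      have h4 : 1 ≤ ‖(x : ℂ) - ρ‖ := by
        have h5 := (le_abs_self _).trans (Complex.abs_re_le_norm ((x : ℂ) - ρ))
        simp only [Complex.sub_re, Complex.ofReal_re] at h5
        linarith
      have h6 : ‖(ρ : ℂ)‖ ≤ ‖(x : ℂ) - ρ‖ := by
        rw [← sq_le_sq₀ (norm_nonneg _) (norm_nonneg _), ← Complex.normSq_eq_norm_sq,
          ← Complex.normSq_eq_norm_sq, Complex.normSq_apply, Complex.normSq_apply]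
        simp only [Complex.sub_re, Complex.ofReal_re, Complex.sub_im, Complex.ofReal_im]
        nlinarith
      have h7 : ‖(ρ : ℂ) - τ‖ ≤ (1 + ‖τ‖) * ‖(x : ℂ) - ρ‖ := by
        have := norm_sub_le (ρ : ℂ) τ
        nlinarith
      have h8 : 0 < ‖(x : ℂ) - ρ‖ := by linarith
      calc |(mult f ρ : ℝ)| * 2 ^ m / ‖(ρ : ℂ) - τ‖ ^ m * ‖(x : ℂ) - ρ‖⁻¹
          = |(mult f ρ : ℝ)| * 2 ^ m / ‖(ρ : ℂ) - τ‖ ^ (m + 1) *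
            (‖(ρ : ℂ) - τ‖ / ‖(x : ℂ) - ρ‖) := by field_simp; ring
        _ ≤ |(mult f ρ : ℝ)| * 2 ^ m / ‖(ρ : ℂ) - τ‖ ^ (m + 1) * (1 + ‖τ‖) := by
            gcongr
            rwa [div_le_iff₀ h8]
        _ = _ := by ring
  simpa [tsum_div_const] using h0

lemma tendsto_mult_div_sub_div (n : ℂ) (τ : ℂ) (m : ℕ) :
    Tendsto (fun x : ℝ ↦ n / ((x : ℂ) - τ) / (x : ℂ) ^ m) atTop (𝓝 0) := by
  have h1 : Tendsto (fun x : ℝ ↦ ‖(x : ℂ) - τ‖) atTop atTop := by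
    refine tendsto_atTop_mono (f := fun x : ℝ ↦ x - ‖τ‖) (fun x ↦ ?_)
      (tendsto_atTop_add_const_right _ _ tendsto_id)
    have := norm_sub_norm_le (x : ℂ) τ
    rw [Complex.norm_real] at this
    linarith [Real.le_norm_self x]
  refine squeeze_zero_norm' (a := fun x : ℝ ↦ ‖n‖ * ‖(x : ℂ) - τ‖⁻¹) ?_ ?_
  · filter_upwards [eventually_ge_atTop 1] with x hx
    rw [norm_div, norm_div, norm_pow, Complex.norm_real, Real.norm_of_nonneg (by linarith)]
    exact (div_le_self (by positivity) (one_le_pow₀ hx)).trans_eq (div_eq_mul_inv _ _)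
  · simpa using h1.inv_tendsto_atTop.const_mul _

/-- Changing the origin of the Hadamard factorization changes the derivative of the Hadamard
polynomial by a polynomial of degree less than `m = d - 1`. -/
theorem degree_derivative_sub_derivative_lt (hf : Meromorphic f) (hd : 1 ≤ convergenceExponent f)
    (hleft : HasLeftDivisor f) {τ σ : ℂ} {Q₀ Q : Polynomial ℂ} (hQ₀ : IsHadamardPolynomial f τ Q₀)
    (hQ : IsHadamardPolynomial f σ Q) :
    (Polynomial.derivative Q - Polynomial.derivative Q₀).degree <
      (convergenceExponent f - 1 : ℕ) := by
  obtain ⟨σ₁, hσ₁⟩ := hleft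
  refine degree_lt_of_tendsto _ _ ?_
  have h := ((tendsto_mult_div_sub_div (mult f τ) τ (convergenceExponent f - 1)).add
    (tendsto_tsum_fractionTerm_div hd hσ₁ τ)).sub
    ((tendsto_mult_div_sub_div (mult f σ) σ (convergenceExponent f - 1)).add
    (tendsto_tsum_fractionTerm_div hd hσ₁ σ))
  simp only [add_zero, sub_zero] at h
  refine h.congr' ?_
  filter_upwards [eventually_gt_atTop σ₁] with x hx
  have hm : mult f (x : ℂ) = 0 := mult_eq_zero_of_lt hσ₁ (by simpa using hx)
  have h1 := (analyticAt_logDerivative hf hd hQ₀ hm).2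
  rw [(analyticAt_logDerivative hf hd hQ hm).2] at h1
  rw [← add_div, ← add_div, ← sub_div, Polynomial.eval_sub]
  congr 1
  linear_combination -h1

lemma degree_derivative_lt_natDegree (Q : Polynomial ℂ) :
    (Polynomial.derivative Q).degree < Q.natDegree := by
  rcases eq_or_ne Q 0 with rfl | h
  · simp
  · exact (Polynomial.degree_derivative_lt h).trans_le Polynomial.degree_le_natDegree

/-- The discrepancy polynomial `-Q_σ'` has degree less than the genus: `Q_τ'` has degree less than
that of `Q_τ`, and the change of origin costs a polynomial of degree less than `d - 1`. -/
theorem degree_discrepancy_lt (hf : Meromorphic f) (hd : 1 ≤ convergenceExponent f)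
    (hleft : HasLeftDivisor f) {τ σ : ℂ} {Q₀ Q : Polynomial ℂ} (hQ₀ : IsHadamardPolynomial f τ Q₀)
    (hQ : IsHadamardPolynomial f σ Q) :
    (-Polynomial.derivative Q).degree < (max Q₀.natDegree (convergenceExponent f - 1) : ℕ) := by
  have h1 := degree_derivative_sub_derivative_lt hf hd hleft hQ₀ hQ
  have h2 := degree_derivative_lt_natDegree Q₀
  rw [Polynomial.degree_neg, ← sub_add_cancel (Polynomial.derivative Q) (Polynomial.derivative Q₀)]
  refine (Polynomial.degree_add_le _ _).trans_lt (max_lt ?_ ?_)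
  · exact h1.trans_le (by exact_mod_cast le_max_right _ _)
  · exact h2.trans_le (by exact_mod_cast le_max_left _ _)

end

section

/-! ### Laplace transforms of test functions -/

/-- `χ` is a complex-valued test function on `ℝ`. -/
def IsTest (χ : ℝ → ℂ) : Prop := ContDiff ℝ ((⊤ : ℕ∞) : WithTop ℕ∞) χ ∧ HasCompactSupport χ

/-- The two-sided Laplace transform `∫ χ(t) e^{st} dt`; with this sign it is an entire function
that pairs with `𝓛⁻¹`. -/
noncomputable def laplaceTest (χ : ℝ → ℂ) (s : ℂ) : ℂ := ∫ t : ℝ, χ t * Complex.exp (s * t)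

variable {χ : ℝ → ℂ}

lemma IsTest.iteratedDeriv (h : IsTest χ) (k : ℕ) : IsTest (iteratedDeriv k χ) := by
  rw [iteratedDeriv_eq_iterate]
  induction k with
  | zero => exact h
  | succ k ih =>
    rw [Function.iterate_succ_apply']
    exact ⟨ih.1.iterate_deriv 1, ih.2.deriv⟩

lemma IsTest.mul_cexp (h : IsTest χ) (a : ℂ) : IsTest fun t : ℝ ↦ χ t * Complex.exp (a * t) :=
  ⟨h.1.mul (contDiff_cexp_mul a), h.2.mul_right⟩

lemma IsTest.integrable (h : IsTest χ) : Integrable χ :=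
  h.1.continuous.integrable_of_hasCompactSupport h.2

lemma IsTest.integrable_mul_cexp (h : IsTest χ) (a : ℂ) :
    Integrable fun t : ℝ ↦ χ t * Complex.exp (a * t) := (h.mul_cexp a).integrable

lemma hasDerivAt_cexp_mul (s : ℂ) (t : ℝ) :
    HasDerivAt (fun t : ℝ ↦ Complex.exp (s * t)) (Complex.exp (s * t) * s) t := by
  have h := ((Complex.ofRealCLM.hasDerivAt (x := t)).const_mul s).cexp
  simpa using h

lemma laplaceTest_deriv (h : IsTest χ) (s : ℂ) :
    laplaceTest (deriv χ) s = -s * laplaceTest χ s := by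
  have hd : IsTest (deriv χ) := by simpa using h.iteratedDeriv 1
  have h1 := integral_mul_deriv_eq_deriv_mul_of_integrable (u := fun t : ℝ ↦ Complex.exp (s * t))
    (v := χ) (fun t _ ↦ hasDerivAt_cexp_mul s t)
    (fun t _ ↦ (h.1.differentiable (by simp) t).hasDerivAt)
    ((hd.integrable_mul_cexp s).congr (ae_of_all _ fun t ↦ by simp [mul_comm]))
    (((h.integrable_mul_cexp s).const_mul s).congr (ae_of_all _ fun t ↦ by
      simp only [Pi.mul_apply]; ring))
    ((h.integrable_mul_cexp s).congr (ae_of_all _ fun t ↦ by simp [mul_comm]))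
  simp only [laplaceTest]
  rw [← integral_const_mul]
  rw [← integral_neg] at h1
  calc _ = ∫ t : ℝ, Complex.exp (s * t) * deriv χ t := by simp_rw [mul_comm]
    _ = _ := h1
    _ = _ := integral_congr_ae (ae_of_all _ fun t ↦ by simp only; ring)

lemma laplaceTest_iteratedDeriv (h : IsTest χ) (k : ℕ) (s : ℂ) :
    laplaceTest (iteratedDeriv k χ) s = (-s) ^ k * laplaceTest χ s := by
  induction k with
  | zero => simp
  | succ k ih =>
    rw [iteratedDeriv_succ, laplaceTest_deriv (h.iteratedDeriv k), ih, pow_succ']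
    ring

lemma laplaceTest_mul_cexp (χ : ℝ → ℂ) (a s : ℂ) :
    laplaceTest (fun t ↦ χ t * Complex.exp (a * t)) s = laplaceTest χ (s + a) := by
  simp only [laplaceTest, mul_assoc, ← Complex.exp_add]
  refine integral_congr_ae (ae_of_all _ fun t ↦ ?_)
  simp only
  ring_nf

/-- The point `c + iu` of the line `Re s = c`. -/
noncomputable abbrev line (c u : ℝ) : ℂ := (c : ℂ) + u * Complex.I

lemma line_re (c u : ℝ) : (line c u).re = c := by simp

lemma continuous_line (c : ℝ) : Continuous (line c) := by fun_prop

lemma norm_laplaceTest_le (χ : ℝ → ℂ) (s : ℂ) :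
    ‖laplaceTest χ s‖ ≤ ∫ t : ℝ, ‖χ t‖ * Real.exp (s.re * t) := by
  refine (norm_integral_le_integral_norm _).trans_eq (integral_congr_ae (ae_of_all _ fun t ↦ ?_))
  simp [Complex.norm_exp]

lemma continuous_laplaceTest_line (h : IsTest χ) (c : ℝ) :
    Continuous fun u ↦ laplaceTest χ (line c u) := by
  refine continuous_of_dominated (bound := fun t ↦ ‖χ t‖ * Real.exp (c * t)) (fun u ↦ ?_)
    (fun u ↦ ae_of_all _ fun t ↦ ?_) ?_ (ae_of_all _ fun t ↦ by fun_prop)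
  · exact (h.integrable_mul_cexp _).aestronglyMeasurable
  · simp [Complex.norm_exp]
  · refine (h.integrable_mul_cexp c).norm.congr (ae_of_all _ fun t ↦ ?_)
    simp [Complex.norm_exp]

lemma one_add_sq_le (c u : ℝ) : 1 + u ^ 2 ≤ (1 + ‖line c u‖) ^ 2 := by
  have h1 : |u| ≤ ‖line c u‖ := by simpa using Complex.abs_im_le_norm (line c u)
  have h2 := abs_nonneg u
  rw [← sq_abs]
  nlinarith

/-- On vertical lines the Laplace transform of a test function decays faster than any power. -/
lemma exists_norm_laplaceTest_le (h : IsTest χ) (c : ℝ) (k : ℕ) :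
    ∃ C : ℝ, ∀ u : ℝ, (1 + ‖line c u‖) ^ k * ‖laplaceTest χ (line c u)‖ ≤ C * (1 + u ^ 2)⁻¹ := by
  set M : ℕ → ℝ := fun j ↦ ∫ t : ℝ, ‖iteratedDeriv j χ t‖ * Real.exp (c * t)
  have hM : ∀ j u, ‖line c u‖ ^ j * ‖laplaceTest χ (line c u)‖ ≤ M j := by
    intro j u
    have h1 := norm_laplaceTest_le (iteratedDeriv j χ) (line c u)
    rwa [laplaceTest_iteratedDeriv h, norm_mul, norm_pow, norm_neg, line_re] at h1
  refine ⟨2 ^ (k + 2 - 1) * (M 0 + M (k + 2)), fun u ↦ ?_⟩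
  rw [← div_eq_mul_inv, le_div_iff₀ (by positivity)]
  have h0 := hM 0 u
  have h2 := hM (k + 2) u
  rw [pow_zero, one_mul] at h0
  calc (1 + ‖line c u‖) ^ k * ‖laplaceTest χ (line c u)‖ * (1 + u ^ 2)
      ≤ (1 + ‖line c u‖) ^ k * ‖laplaceTest χ (line c u)‖ * (1 + ‖line c u‖) ^ 2 := by
        gcongr; exact one_add_sq_le c u
    _ = (1 + ‖line c u‖) ^ (k + 2) * ‖laplaceTest χ (line c u)‖ := by ring
    _ ≤ 2 ^ (k + 2 - 1) * (1 ^ (k + 2) + ‖line c u‖ ^ (k + 2)) * ‖laplaceTest χ (line c u)‖ := by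
        gcongr; exact add_pow_le zero_le_one (norm_nonneg _) _
    _ = 2 ^ (k + 2 - 1) * (‖laplaceTest χ (line c u)‖ +
          ‖line c u‖ ^ (k + 2) * ‖laplaceTest χ (line c u)‖) := by rw [one_pow]; ring
    _ ≤ _ := by gcongr

lemma integrable_pow_mul_laplaceTest (h : IsTest χ) (c : ℝ) (k : ℕ) :
    Integrable fun u : ℝ ↦ (1 + ‖line c u‖) ^ k * ‖laplaceTest χ (line c u)‖ := by
  obtain ⟨C, hC⟩ := exists_norm_laplaceTest_le h c k
  refine (integrable_inv_one_add_sq.const_mul C).mono' ?_ (ae_of_all _ fun u ↦ ?_)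
  · exact Continuous.aestronglyMeasurable
      (by have := (continuous_laplaceTest_line h c).norm; fun_prop)
  · rw [Real.norm_of_nonneg (by positivity)]
    exact hC u

lemma integrable_mul_laplaceTest (h : IsTest χ) (c : ℝ) (k : ℕ) (A : ℝ) {G : ℝ → ℂ}
    (hG : Continuous G) (hb : ∀ u, ‖G u‖ ≤ A * (1 + ‖line c u‖) ^ k) :
    Integrable fun u : ℝ ↦ G u * laplaceTest χ (line c u) := by
  refine ((integrable_pow_mul_laplaceTest h c k).const_mul A).mono'
    (hG.mul (continuous_laplaceTest_line h c)).aestronglyMeasurable (ae_of_all _ fun u ↦ ?_)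
  rw [norm_mul, ← mul_assoc]
  gcongr
  exact hb u

lemma integrable_laplaceTest (h : IsTest χ) (c : ℝ) :
    Integrable fun u : ℝ ↦ laplaceTest χ (line c u) := by
  simpa using integrable_mul_laplaceTest h c 0 1 (G := fun _ ↦ 1) continuous_const (by simp)

/-- Fourier inversion for test functions, written as an integral over the line `Re s = c`. -/
lemma laplaceTest_inversion (h : IsTest χ) (c t : ℝ) :
    χ t = (2 * Real.pi : ℂ)⁻¹ *
      ∫ u : ℝ, laplaceTest χ (line c u) * Complex.exp (-(line c u) * t) := by
  set g : ℝ → ℂ := fun t ↦ χ t * Complex.exp (c * t)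
  have hg : IsTest g := h.mul_cexp c
  have hF : ∀ v : ℝ, FourierTransform.fourier g v =
      laplaceTest χ (line c (-(2 * Real.pi) * v)) := by
    intro v
    rw [Real.fourier_real_eq_integral_exp_smul]
    refine integral_congr_ae (ae_of_all _ fun x ↦ ?_)
    simp only [g, smul_eq_mul]
    rw [mul_left_comm, ← Complex.exp_add]
    congr 2
    simp only [line]
    push_cast
    ring
  have hpi : -(2 * Real.pi) ≠ 0 := by simp [Real.pi_ne_zero]
  have hFi : Integrable (FourierTransform.fourier g) := by
    have h1 := (integrable_laplaceTest h c).comp_mul_left' hpi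
    exact h1.congr (ae_of_all _ fun v ↦ (hF v).symm)
  have h2 := congr_fun (hg.1.continuous.fourierInv_fourier_eq hg.integrable hFi) t
  rw [Real.fourierInv_eq'] at h2
  have h3 := Measure.integral_comp_mul_left
    (fun u : ℝ ↦ laplaceTest χ (line c u) * Complex.exp (-(u * Complex.I) * t)) (-(2 * Real.pi))
  have h4 : (∫ v : ℝ, Complex.exp (↑(2 * Real.pi * inner ℝ v t) * Complex.I) •
      FourierTransform.fourier g v) = ∫ v : ℝ, laplaceTest χ (line c (-(2 * Real.pi) * v)) *
        Complex.exp (-(((-(2 * Real.pi) * v : ℝ) : ℂ) * Complex.I) * t) := by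
    refine integral_congr_ae (ae_of_all _ fun v ↦ ?_)
    simp only [hF, smul_eq_mul]
    rw [mul_comm]
    congr 2
    simp
    ring
  rw [h4, h3] at h2
  have h5 : |(-(2 * Real.pi))⁻¹| = (2 * Real.pi)⁻¹ := by
    rw [inv_neg, abs_neg, abs_of_pos (by positivity)]
  rw [h5, Complex.real_smul] at h2
  have h6 : χ t = g t * Complex.exp (-(c * t)) := by
    simp only [g]
    rw [mul_assoc, ← Complex.exp_add, add_neg_cancel, Complex.exp_zero, mul_one]
  rw [h6, ← h2, mul_assoc, ← integral_mul_const]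
  push_cast
  congr 1
  refine integral_congr_ae (ae_of_all _ fun v ↦ ?_)
  simp only
  rw [mul_assoc, ← Complex.exp_add]
  congr 2
  ring

/-- The pairing of `δ₀^{(k)}` with a test function, as an integral over the line `Re s = c`. -/
lemma iteratedDeriv_zero_eq_integral (h : IsTest χ) (c : ℝ) (k : ℕ) :
    (-1) ^ k * iteratedDeriv k χ 0 =
      (2 * Real.pi : ℂ)⁻¹ * ∫ u : ℝ, (line c u) ^ k * laplaceTest χ (line c u) := by
  rw [laplaceTest_inversion (h.iteratedDeriv k) c 0, mul_left_comm, ← integral_const_mul]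
  congr 1
  refine integral_congr_ae (ae_of_all _ fun v ↦ ?_)
  simp only [Complex.ofReal_zero, mul_zero, Complex.exp_zero, mul_one]
  rw [laplaceTest_iteratedDeriv h, ← mul_assoc, ← mul_pow]
  simp

/-- The half-line pairing of a test function with an exponential, as an integral over a vertical
line to the right of the exponent. -/
lemma integral_Ioi_mul_cexp (h : IsTest χ) {c : ℝ} {a : ℂ} (ha : a.re < c) :
    ∫ t in Set.Ioi (0 : ℝ), χ t * Complex.exp (a * t) =
      (2 * Real.pi : ℂ)⁻¹ * ∫ u : ℝ, laplaceTest χ (line c u) / (line c u - a) := by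
  have hE : IntegrableOn (fun t : ℝ ↦ Real.exp ((a.re - c) * t)) (Set.Ioi 0) := by
    have := integrableOn_exp_mul_Ioi (a := a.re - c) (by linarith) 0
    exact this
  have hprod : Integrable (Function.uncurry fun (t u : ℝ) ↦
      Complex.exp ((a - line c u) * t) * laplaceTest χ (line c u))
      ((volume.restrict (Set.Ioi 0)).prod volume) := by
    refine (hE.mul_prod (integrable_laplaceTest h c).norm).mono' ?_ (ae_of_all _ fun p ↦ ?_)
    · refine Continuous.aestronglyMeasurable ?_
      have h1 := (continuous_laplaceTest_line h c).comp (continuous_snd (X := ℝ) (Y := ℝ))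
      simp only [Function.comp_def] at h1
      simp only [Function.uncurry_def]
      fun_prop
    · simp [Function.uncurry_def, Complex.norm_exp]
  calc ∫ t in Set.Ioi (0 : ℝ), χ t * Complex.exp (a * t)
      = ∫ t in Set.Ioi (0 : ℝ), (2 * Real.pi : ℂ)⁻¹ *
          ∫ u : ℝ, Complex.exp ((a - line c u) * t) * laplaceTest χ (line c u) := by
        refine integral_congr_ae (ae_of_all _ fun t ↦ ?_)
        simp only
        conv_lhs => rw [laplaceTest_inversion h c t]
        rw [mul_assoc, ← integral_mul_const]
        congr 1
        refine integral_congr_ae (ae_of_all _ fun u ↦ ?_)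
        simp only
        rw [mul_assoc, ← Complex.exp_add, mul_comm]
        congr 2
        ring
    _ = (2 * Real.pi : ℂ)⁻¹ * ∫ u : ℝ, ∫ t in Set.Ioi (0 : ℝ),
          Complex.exp ((a - line c u) * t) * laplaceTest χ (line c u) := by
        rw [integral_const_mul, integral_integral_swap hprod]
    _ = _ := by
        congr 1
        refine integral_congr_ae (ae_of_all _ fun u ↦ ?_)
        simp only
        rw [integral_mul_const, integral_exp_mul_complex_Ioi (by simpa using ha)]
        rw [Complex.ofReal_zero, mul_zero, Complex.exp_zero, neg_div, ← div_neg, neg_sub]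
        ring

/-! ### Interchange of sum and integral -/

/-- Termwise integration for a family over an arbitrary index type: a summable majorant makes all
but countably many terms vanish. -/
lemma tsum_integral_of_norm_le {ι α : Type*} [MeasurableSpace α] {μ : Measure α}
    {F : ι → α → ℂ} {a : ι → ℝ} {G : α → ℝ} (hF : ∀ i, AEStronglyMeasurable (F i) μ)
    (ha : Summable a) (hG : Integrable G μ) (hb : ∀ᵐ t ∂μ, ∀ i, ‖F i t‖ ≤ a i * G t) :
    Integrable (fun t ↦ ∑' i, F i t) μ ∧ ∑' i, ∫ t, F i t ∂μ = ∫ t, ∑' i, F i t ∂μ := by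
  have hc : (Function.support a).Countable := ha.countable_support
  have := hc.to_subtype
  have hz : ∀ᵐ t ∂μ, ∀ i, i ∉ Function.support a → F i t = 0 := by
    filter_upwards [hb] with t ht i hi
    have h1 := ht i
    rw [Function.notMem_support.1 hi, zero_mul] at h1
    exact norm_le_zero_iff.1 h1
  have h1 : ∀ᵐ t ∂μ, ∑' i, F i t = ∑' i : Function.support a, F i t := by
    filter_upwards [hz] with t ht
    exact (tsum_subtype_eq_of_support_subset (f := fun i ↦ F i t)
      fun i hi ↦ by_contra fun h ↦ hi (ht i h)).symm
  have h2 : ∑' i, ∫ t, F i t ∂μ = ∑' i : Function.support a, ∫ t, F i t ∂μ := by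
    refine (tsum_subtype_eq_of_support_subset (f := fun i ↦ ∫ t, F i t ∂μ)
      fun i hi ↦ by_contra fun h ↦ hi ?_).symm
    refine integral_eq_zero_of_ae ?_
    filter_upwards [hz] with t ht
    exact ht i h
  have ha' : Summable fun i : Function.support a ↦ a i := ha.subtype _
  have hi : ∀ i : Function.support a, Integrable (F i) μ := fun i ↦
    (hG.const_mul (a i)).mono' (hF i) (hb.mono fun t ht ↦ ht i)
  have hs : Summable fun i : Function.support a ↦ ∫ t, ‖F i t‖ ∂μ := by
    refine Summable.of_nonneg_of_le (fun i ↦ integral_nonneg fun t ↦ norm_nonneg _) (fun i ↦ ?_)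
      (ha'.mul_right (∫ t, G t ∂μ))
    rw [← integral_const_mul]
    exact integral_mono_ae (hi i).norm (hG.const_mul _) (hb.mono fun t ht ↦ ht i)
  refine ⟨?_, ?_⟩
  · have hm : AEStronglyMeasurable (fun t ↦ ∑' i : Function.support a, F i t) μ :=
      (AEMeasurable.tsum fun i : Function.support a ↦ (hF i).aemeasurable).aestronglyMeasurable
    refine (hG.const_mul (∑' i, a i)).mono' (hm.congr (h1.mono fun t ht ↦ ht.symm)) ?_
    filter_upwards [hb] with t ht
    rw [← tsum_mul_right]
    exact tsum_of_norm_bounded (ha.mul_right _).hasSum ht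
  · rw [h2, integral_congr_ae h1]
    exact integral_tsum_of_summable_integral_norm hi hs

end

section

/-! ### Distributions evaluated on test functions -/

/-- The complexification of a real test function. -/
noncomputable def complexTest (φ : 𝓓((⊤ : TopologicalSpace.Opens ℝ), ℝ)) (t : ℝ) : ℂ := (φ t : ℂ)

lemma isTest_complexTest (φ : 𝓓((⊤ : TopologicalSpace.Opens ℝ), ℝ)) : IsTest (complexTest φ) :=
  ⟨Complex.ofRealCLM.contDiff.comp φ.contDiff,
    φ.hasCompactSupport.comp_left (g := fun x : ℝ ↦ (x : ℂ)) Complex.ofReal_zero⟩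

lemma complexTest_iterate_lineDeriv (φ : 𝓓((⊤ : TopologicalSpace.Opens ℝ), ℝ)) (k : ℕ) :
    complexTest ((fun ψ : 𝓓((⊤ : TopologicalSpace.Opens ℝ), ℝ) ↦ ∂_{(1 : ℝ)} ψ)^[k] φ) =
      iteratedDeriv k (complexTest φ) := by
  induction k with
  | zero => simp
  | succ k ih =>
    rw [Function.iterate_succ_apply', iteratedDeriv_succ, ← ih]
    set ψ := (fun ψ : 𝓓((⊤ : TopologicalSpace.Opens ℝ), ℝ) ↦ ∂_{(1 : ℝ)} ψ)^[k] φ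
    ext t
    have hψ : HasDerivAt (ψ : ℝ → ℝ) (deriv ψ t) t :=
      (ψ.contDiff.differentiable (by simp) t).hasDerivAt
    have h1 : (∂_{(1 : ℝ)} ψ : 𝓓((⊤ : TopologicalSpace.Opens ℝ), ℝ)) t = deriv ψ t := by
      rw [TestFunction.lineDerivOp_eq_lineDerivCLM ℝ,
        TestFunction.lineDerivCLM_apply_of_le (by simp)]
      simp only [lineDeriv, smul_eq_mul, mul_one]
      rw [deriv_comp_const_add, add_zero]
    rw [complexTest, h1]
    exact hψ.ofReal_comp.deriv.symm

lemma distDeriv_iterate_apply (T : Distr) (k : ℕ) (φ : 𝓓((⊤ : TopologicalSpace.Opens ℝ), ℝ)) :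
    distDeriv^[k] T φ =
      (-1) ^ k * T ((fun ψ : 𝓓((⊤ : TopologicalSpace.Opens ℝ), ℝ) ↦ ∂_{(1 : ℝ)} ψ)^[k] φ) := by
  induction k generalizing T with
  | zero => simp
  | succ k ih =>
    rw [Function.iterate_succ_apply, ih, distDeriv, Distribution.lineDerivOp_apply_apply, map_neg,
      Function.iterate_succ_apply']
    ring

lemma ofFun_apply {F : ℝ → ℂ} (hF : LocallyIntegrable F)
    (φ : 𝓓((⊤ : TopologicalSpace.Opens ℝ), ℝ)) :
    ofFun F φ = ∫ t, F t * complexTest φ t := by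
  refine (TestFunction.integralAgainstBilinCLM_eq_integral (hF.locallyIntegrableOn _)).trans ?_
  refine integral_congr_ae (ae_of_all _ fun t ↦ ?_)
  simp [complexTest, mul_comm]

lemma distDeriv_iterate_ofFun_apply {F : ℝ → ℂ} (hF : LocallyIntegrable F) (k : ℕ)
    (φ : 𝓓((⊤ : TopologicalSpace.Opens ℝ), ℝ)) :
    distDeriv^[k] (ofFun F) φ = (-1) ^ k * ∫ t, F t * iteratedDeriv k (complexTest φ) t := by
  rw [distDeriv_iterate_apply, ofFun_apply hF, complexTest_iterate_lineDeriv]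

lemma distDeriv_iterate_dirac_apply (k : ℕ) (φ : 𝓓((⊤ : TopologicalSpace.Opens ℝ), ℝ)) :
    distDeriv^[k] dirac φ = (-1) ^ k * iteratedDeriv k (complexTest φ) 0 := by
  rw [distDeriv_iterate_apply, ← complexTest_iterate_lineDeriv, complexTest, dirac]
  congr 1

lemma integrable_mul_of_isTest {F χ : ℝ → ℂ} (hF : LocallyIntegrable F) (hχ : IsTest χ) :
    Integrable fun t ↦ F t * χ t := by
  simpa [mul_comm] using hF.integrable_smul_left_of_hasCompactSupport hχ.1.continuous hχ.2

lemma expMul_distDeriv_iterate_ofFun_apply {F : ℝ → ℂ} (hF : LocallyIntegrable F) (σ : ℂ) (k : ℕ)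
    (φ : 𝓓((⊤ : TopologicalSpace.Opens ℝ), ℝ)) :
    expMul σ (distDeriv^[k] (ofFun F)) φ =
      (-1) ^ k * ∫ t : ℝ, F t *
        iteratedDeriv k (fun t : ℝ ↦ complexTest φ t * Complex.exp (σ * t)) t := by
  rw [expMul_apply, distDeriv_iterate_ofFun_apply hF, distDeriv_iterate_ofFun_apply hF]
  set φ₁ := mulTest (fun t ↦ (Complex.exp (σ * t)).re)
    (Complex.reCLM.contDiff.comp (contDiff_cexp_mul σ)) φ
  set φ₂ := mulTest (fun t ↦ (Complex.exp (σ * t)).im)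
    (Complex.imCLM.contDiff.comp (contDiff_cexp_mul σ)) φ
  have h1 := isTest_complexTest φ₁
  have h2 := isTest_complexTest φ₂
  have h : (fun t : ℝ ↦ complexTest φ t * Complex.exp (σ * t)) =
      complexTest φ₁ + Complex.I • complexTest φ₂ := by
    ext t
    have e1 : φ₁ t = φ t * (Complex.exp (σ * t)).re := rfl
    have e2 : φ₂ t = φ t * (Complex.exp (σ * t)).im := rfl
    simp only [complexTest, Pi.add_apply, Pi.smul_apply, smul_eq_mul, e1, e2]
    conv_lhs => rw [← Complex.re_add_im (Complex.exp (σ * t))]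
    push_cast
    ring
  have hk : ∀ t, iteratedDeriv k (complexTest φ₁ + Complex.I • complexTest φ₂) t =
      iteratedDeriv k (complexTest φ₁) t + Complex.I * iteratedDeriv k (complexTest φ₂) t := by
    intro t
    have hle : (k : WithTop ℕ∞) ≤ ((⊤ : ℕ∞) : WithTop ℕ∞) := by exact_mod_cast le_top
    have h3 : ContDiffAt ℝ k (Complex.I • complexTest φ₂) t :=
      (h2.1.contDiffAt.of_le hle).const_smul Complex.I
    rw [iteratedDeriv_add (h1.1.contDiffAt.of_le hle) h3, iteratedDeriv_const_smul_field]
    rfl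
  rw [h]
  simp_rw [hk, mul_add, mul_left_comm _ Complex.I]
  rw [integral_add (integrable_mul_of_isTest hF (h1.iteratedDeriv k))
    ((integrable_mul_of_isTest hF (h2.iteratedDeriv k)).const_mul _), integral_const_mul]
  ring

/-! ### The inverse Laplace transform on test functions -/

variable {F : ℂ → ℂ} {c : ℝ} {m₀ : ℕ}

lemma LaplaceAdmissible.pos (h : LaplaceAdmissible F c m₀) : 0 < c := by
  obtain ⟨σ₂, _, h0, h1, -⟩ := h
  exact h0.trans h1

lemma line_ne_zero (hc : 0 < c) (u : ℝ) : line c u ≠ 0 := by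
  intro h
  have := line_re c u
  rw [h, Complex.zero_re] at this
  exact hc.ne this

lemma LaplaceAdmissible.continuous_line (h : LaplaceAdmissible F c m₀) :
    Continuous fun u ↦ F (line c u) := by
  obtain ⟨σ₂, C, h0, h1, h2, -⟩ := h
  refine h2.continuousOn.comp_continuous (PoissonNewton.continuous_line c) fun u ↦ ?_
  simpa using h1

lemma LaplaceAdmissible.integrable (h : LaplaceAdmissible F c m₀) :
    Integrable fun u ↦ F (line c u) / (line c u) ^ m₀ := by
  have hc := h.pos
  have hcont := h.continuous_line
  obtain ⟨σ₂, C, h0, h1, -, h3⟩ := h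
  have hm : Continuous fun u ↦ F (line c u) / (line c u) ^ m₀ :=
    hcont.div ((PoissonNewton.continuous_line c).pow _) fun u ↦ pow_ne_zero _ (line_ne_zero hc u)
  have hC : 0 ≤ C := by
    have h4 := h3 (line c 0) (by simpa using h1)
    have h5 : 0 < ‖line c 0‖ := norm_pos_iff.2 (line_ne_zero hc 0)
    have h6 : 0 ≤ C / ‖line c 0‖ ^ 2 := le_trans (by positivity) h4
    have h7 : 0 < ‖line c 0‖ ^ 2 := by positivity
    by_contra! hneg
    exact absurd h6 (not_le.2 (div_neg_of_neg_of_pos hneg h7))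
  set K := min (c ^ 2) 1
  have hK : 0 < K := lt_min (by positivity) one_pos
  refine (integrable_inv_one_add_sq.const_mul (C / K)).mono' hm.aestronglyMeasurable
    (ae_of_all _ fun u ↦ ?_)
  rw [norm_div, norm_pow]
  refine (h3 _ (by simpa using h1)).trans ?_
  rw [← div_eq_mul_inv, div_div]
  gcongr
  have h8 : ‖line c u‖ ^ 2 = c ^ 2 + u ^ 2 := by
    rw [← Complex.normSq_eq_norm_sq, Complex.normSq_apply]
    simp
    ring
  rw [h8, mul_add, mul_one]
  gcongr
  · exact min_le_left _ _
  · exact mul_le_of_le_one_left (sq_nonneg u) (min_le_right _ _)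

lemma LaplaceAdmissible.continuous_bromwich (h : LaplaceAdmissible F c m₀) :
    Continuous (bromwich F c m₀) := by
  have h1 : Continuous fun t : ℝ ↦ ∫ u : ℝ, F (line c u) / (line c u) ^ m₀ *
      Complex.exp (u * Complex.I * t) := by
    refine continuous_of_dominated (bound := fun u ↦ ‖F (line c u) / (line c u) ^ m₀‖)
      (fun t ↦ h.integrable.aestronglyMeasurable.mul
        (Continuous.aestronglyMeasurable (by fun_prop)))
      (fun t ↦ ae_of_all _ fun u ↦ ?_) h.integrable.norm (ae_of_all _ fun u ↦ by fun_prop)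
    rw [norm_mul, Complex.norm_exp]
    simp
  have h2 : bromwich F c m₀ = fun t : ℝ ↦ (2 * Real.pi : ℂ)⁻¹ * (Complex.exp (c * t) *
      ∫ u : ℝ, F (line c u) / (line c u) ^ m₀ * Complex.exp (u * Complex.I * t)) := by
    ext t
    rw [bromwich]
    congr 1
    rw [← integral_const_mul]
    refine integral_congr_ae (ae_of_all _ fun u ↦ ?_)
    simp only [line]
    rw [add_mul (c : ℂ), Complex.exp_add]
    ring
  rw [h2]
  fun_prop

/-- By Fubini, the inverse Laplace transform pairs `F` with the Laplace transform of the test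
function along the line `Re s = c`. -/
theorem LaplaceAdmissible.inverseLaplace_apply (h : LaplaceAdmissible F c m₀)
    (φ : 𝓓((⊤ : TopologicalSpace.Opens ℝ), ℝ)) :
    inverseLaplace F c m₀ φ = (2 * Real.pi : ℂ)⁻¹ *
      ∫ u : ℝ, F (line c u) * laplaceTest (complexTest φ) (line c u) := by
  rw [inverseLaplace, distDeriv_iterate_ofFun_apply h.continuous_bromwich.locallyIntegrable]
  have hφ := isTest_complexTest φ
  set χ := iteratedDeriv m₀ (complexTest φ) with hχdef
  have hχ : IsTest χ := hφ.iteratedDeriv m₀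
  have hprod : Integrable (Function.uncurry fun (t u : ℝ) ↦
      F (line c u) / (line c u) ^ m₀ * Complex.exp (line c u * t) * χ t)
      ((volume : Measure ℝ).prod volume) := by
    refine ((hχ.integrable_mul_cexp c).norm.mul_prod h.integrable.norm).mono' ?_
      (ae_of_all _ fun p ↦ ?_)
    · refine AEStronglyMeasurable.mul (AEStronglyMeasurable.mul ?_ ?_) ?_
      · exact h.integrable.aestronglyMeasurable.comp_snd
      · exact Continuous.aestronglyMeasurable (by fun_prop)
      · exact hχ.integrable.aestronglyMeasurable.comp_fst
    · refine le_of_eq ?_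
      simp only [Function.uncurry_def, norm_mul, Complex.norm_exp]
      simp
      ring
  calc (-1) ^ m₀ * ∫ t, bromwich F c m₀ t * χ t
      = (-1) ^ m₀ * ((2 * Real.pi : ℂ)⁻¹ * ∫ t : ℝ, ∫ u : ℝ,
          F (line c u) / (line c u) ^ m₀ * Complex.exp (line c u * t) * χ t) := by
        congr 1
        rw [← integral_const_mul]
        refine integral_congr_ae (ae_of_all _ fun t ↦ ?_)
        simp only [bromwich, integral_mul_const]
        ring
    _ = (2 * Real.pi : ℂ)⁻¹ * ∫ u : ℝ, (-1) ^ m₀ * ∫ t : ℝ,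
          F (line c u) / (line c u) ^ m₀ * Complex.exp (line c u * t) * χ t := by
        rw [integral_integral_swap hprod, integral_const_mul]
        ring
    _ = _ := by
        congr 1
        refine integral_congr_ae (ae_of_all _ fun u ↦ ?_)
        simp only
        have h1 : ∫ t : ℝ, F (line c u) / (line c u) ^ m₀ * Complex.exp (line c u * t) * χ t =
            F (line c u) / (line c u) ^ m₀ * laplaceTest χ (line c u) := by
          rw [laplaceTest, ← integral_const_mul]
          refine integral_congr_ae (ae_of_all _ fun t ↦ ?_)
          simp only
          ring
        rw [h1, hχdef, laplaceTest_iteratedDeriv hφ, neg_pow (line c u)]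
        have h2 : (line c u) ^ m₀ ≠ 0 := pow_ne_zero _ (line_ne_zero h.pos u)
        have h3 : ((-1 : ℂ) ^ m₀) * (-1) ^ m₀ = 1 := by rw [← mul_pow]; simp
        field_simp
        linear_combination (F (line c u) * laplaceTest (complexTest φ) (line c u)) * h3

end

section

variable {f : ℂ → ℂ}

/-! ### The series defining the kernel -/

lemma norm_kernelTerm_le {σ₂ : ℝ} (hσ₂ : ∀ ρ : ℂ, mult f ρ ≠ 0 → ρ.re ≤ σ₂) (d : ℕ) (σ : ℂ)
    {t : ℝ} (ht : 0 ≤ t) (ρ : {ρ : ℂ // ρ ≠ σ}) :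
    ‖kernelTerm f d σ t ρ‖ ≤
      |(mult f ρ : ℝ)| / ‖(ρ : ℂ) - σ‖ ^ d * Real.exp ((σ₂ - σ.re) * t) := by
  by_cases hρ : mult f ρ = 0
  · simp [kernelTerm, hρ]
  have h1 := hσ₂ ρ hρ
  rw [kernelTerm, norm_mul, norm_div, norm_pow, Complex.norm_intCast, Complex.norm_exp]
  gcongr
  simp only [Complex.mul_re, Complex.sub_re, Complex.ofReal_re, Complex.ofReal_im, mul_zero,
    sub_zero]
  gcongr

lemma summable_mult_div' (hd : 1 ≤ convergenceExponent f) (σ : ℂ) :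
    Summable fun ρ : {ρ : ℂ // ρ ≠ σ} ↦
      |(mult f ρ : ℝ)| / ‖(ρ : ℂ) - σ‖ ^ convergenceExponent f := by
  simpa only [one_add_sub_convergenceExponent hd] using summable_mult_div hd σ

lemma summable_kernelTerm (hd : 1 ≤ convergenceExponent f) {σ₂ : ℝ}
    (hσ₂ : ∀ ρ : ℂ, mult f ρ ≠ 0 → ρ.re ≤ σ₂) (σ : ℂ) {t : ℝ} (ht : 0 ≤ t) :
    Summable (kernelTerm f (convergenceExponent f) σ t) :=
  .of_norm_bounded ((summable_mult_div' hd σ).mul_right _)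
    fun ρ ↦ norm_kernelTerm_le hσ₂ _ σ ht ρ

lemma continuous_kernel_max (hd : 1 ≤ convergenceExponent f) {σ₂ : ℝ}
    (hσ₂ : ∀ ρ : ℂ, mult f ρ ≠ 0 → ρ.re ≤ σ₂) (σ : ℂ) :
    Continuous fun t : ℝ ↦ kernel f (convergenceExponent f) σ (max t 0) := by
  set d := convergenceExponent f
  -- Factoring out the largest possible growth makes the series uniformly convergent.
  have h1 : Continuous fun t : ℝ ↦ ∑' ρ : {ρ : ℂ // ρ ≠ σ},
      kernelTerm f d σ (max t 0) ρ * Complex.exp (-((σ₂ - σ.re : ℝ) : ℂ) * (max t 0 : ℝ)) := by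
    refine continuous_tsum (fun ρ ↦ ?_) (summable_mult_div' hd σ) fun ρ t ↦ ?_
    · unfold kernelTerm
      fun_prop
    · rw [norm_mul]
      refine (mul_le_mul_of_nonneg_right (norm_kernelTerm_le hσ₂ d σ (le_max_right t 0) ρ)
        (norm_nonneg _)).trans_eq ?_
      rw [Complex.norm_exp, mul_assoc, ← Real.exp_add]
      have h0 : (σ₂ - σ.re) * max t 0 +
          (-((σ₂ - σ.re : ℝ) : ℂ) * ((max t 0 : ℝ) : ℂ)).re = 0 := by
        rw [← Complex.ofReal_neg, ← Complex.ofReal_mul, Complex.ofReal_re]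
        ring
      rw [h0, Real.exp_zero, mul_one]
  have h2 : (fun t : ℝ ↦ kernel f d σ (max t 0)) = fun t : ℝ ↦
      (mult f σ : ℂ) * ((max t 0 : ℝ) : ℂ) ^ d / (d.factorial : ℂ) +
      (∑' ρ : {ρ : ℂ // ρ ≠ σ},
        kernelTerm f d σ (max t 0) ρ * Complex.exp (-((σ₂ - σ.re : ℝ) : ℂ) * (max t 0 : ℝ))) *
        Complex.exp (((σ₂ - σ.re : ℝ) : ℂ) * (max t 0 : ℝ)) := by
    ext t
    rw [tsum_mul_right, mul_assoc, ← Complex.exp_add, neg_mul, neg_add_cancel, Complex.exp_zero,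
      mul_one, kernel]
  rw [h2]
  fun_prop

lemma indicator_kernel_sub (f : ℂ → ℂ) (d : ℕ) (σ : ℂ) :
    (Set.indicator (Set.Ici (0 : ℝ)) fun t ↦ kernel f d σ t - kernel f d σ 0) =
      fun t ↦ kernel f d σ (max t 0) - kernel f d σ 0 := by
  ext t
  rcases le_or_gt 0 t with h | h
  · rw [Set.indicator_of_mem (Set.mem_Ici.2 h), max_eq_left h]
  · rw [Set.indicator_of_notMem (by simpa using h), max_eq_right h.le, sub_self]

lemma kernel_sub_kernel_zero (hd : 1 ≤ convergenceExponent f) {σ₂ : ℝ}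
    (hσ₂ : ∀ ρ : ℂ, mult f ρ ≠ 0 → ρ.re ≤ σ₂) (σ : ℂ) {t : ℝ} (ht : 0 ≤ t) :
    kernel f (convergenceExponent f) σ t - kernel f (convergenceExponent f) σ 0 =
      (mult f σ : ℂ) * ((t : ℂ) ^ convergenceExponent f / (convergenceExponent f).factorial) +
        ∑' ρ, (kernelTerm f (convergenceExponent f) σ t ρ -
          kernelTerm f (convergenceExponent f) σ 0 ρ) := by
  rw [(summable_kernelTerm hd hσ₂ σ ht).tsum_sub (summable_kernelTerm hd hσ₂ σ le_rfl), kernel,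
    kernel, Complex.ofReal_zero, zero_pow (by omega : convergenceExponent f ≠ 0)]
  ring

/-! ### The two sides on a test function, term by term -/

variable {χ : ℝ → ℂ}

lemma integral_Ioi_iteratedDeriv_succ (h : IsTest χ) (k : ℕ) :
    ∫ t in Set.Ioi (0 : ℝ), iteratedDeriv (k + 1) χ t = -iteratedDeriv k χ 0 := by
  have hk := h.iteratedDeriv k
  rw [iteratedDeriv_succ]
  exact hk.2.integral_Ioi_deriv_eq (hk.1.of_le (by exact_mod_cast le_top)) 0

/-- Integrating by parts `k` times: `t^k / k!` on the half-line is a `k`-fold primitive of the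
Heaviside function. -/
lemma integral_Ioi_pow_mul_iteratedDeriv (h : IsTest χ) (k : ℕ) :
    (-1) ^ k * ∫ t in Set.Ioi (0 : ℝ), (t : ℂ) ^ k / k.factorial * iteratedDeriv k χ t =
      ∫ t in Set.Ioi (0 : ℝ), χ t := by
  induction k with
  | zero => simp
  | succ k ih =>
    rw [← ih]
    have hk := h.iteratedDeriv k
    have hpow : ∀ j : ℕ, ContDiff ℝ ((⊤ : ℕ∞) : WithTop ℕ∞) fun t : ℝ ↦
        (t : ℂ) ^ j / j.factorial := fun j ↦ (Complex.ofRealCLM.contDiff.pow j).div_const _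
    have hint : ∀ (j : ℕ) {χ : ℝ → ℂ}, IsTest χ → IntegrableOn (fun t : ℝ ↦
        (t : ℂ) ^ j / j.factorial * χ t) (Set.Ioi 0) := fun j χ hχ ↦
      (IsTest.integrable ⟨(hpow j).mul hχ.1, hχ.2.mul_left⟩).integrableOn
    have h1 := HasCompactSupport.integral_Ioi_deriv_eq
      (f := fun t : ℝ ↦ (t : ℂ) ^ (k + 1) / (k + 1).factorial * iteratedDeriv k χ t)
      (((hpow (k + 1)).mul hk.1).of_le (by exact_mod_cast le_top)) hk.2.mul_left 0
    have h2 : ∀ t : ℝ, deriv (fun t : ℝ ↦ (t : ℂ) ^ (k + 1) / (k + 1).factorial *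
        iteratedDeriv k χ t) t = (t : ℂ) ^ k / k.factorial * iteratedDeriv k χ t +
          (t : ℂ) ^ (k + 1) / (k + 1).factorial * iteratedDeriv (k + 1) χ t := by
      intro t
      have e1 : HasDerivAt (fun t : ℝ ↦ (t : ℂ) ^ (k + 1) / (k + 1).factorial)
          ((t : ℂ) ^ k / k.factorial) t := by
        refine (((Complex.ofRealCLM.hasDerivAt (x := t)).pow (k + 1)).div_const _).congr_deriv ?_
        have : (k.factorial : ℂ) ≠ 0 := by exact_mod_cast k.factorial_ne_zero
        have : (k : ℂ) + 1 ≠ 0 := by exact_mod_cast k.succ_ne_zero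
        rw [Nat.factorial_succ]
        push_cast
        simp
        field_simp
      have e2 : HasDerivAt (iteratedDeriv k χ) (iteratedDeriv (k + 1) χ t) t := by
        rw [iteratedDeriv_succ]
        exact (hk.1.differentiable (by simp) t).hasDerivAt
      exact (e1.mul e2).deriv
    simp_rw [h2] at h1
    rw [integral_add (hint k hk) (hint (k + 1) (h.iteratedDeriv (k + 1)))] at h1
    simp only [Complex.ofReal_zero, ne_eq, Nat.add_eq_zero_iff, one_ne_zero, and_false,
      not_false_eq_true, zero_pow, zero_div, zero_mul, neg_zero] at h1
    rw [pow_succ]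
    linear_combination (-1 : ℂ) ^ k * (-h1)

/-- The function `e^{-σt} (e^{σt} χ)^{(k)}`, that is the operator `(d/dt + σ)^k` applied to `χ`. -/
noncomputable def twistedDeriv (σ : ℂ) (k : ℕ) (χ : ℝ → ℂ) (t : ℝ) : ℂ :=
  iteratedDeriv k (fun t : ℝ ↦ χ t * Complex.exp (σ * t)) t * Complex.exp (-σ * t)

lemma IsTest.twistedDeriv (h : IsTest χ) (σ : ℂ) (k : ℕ) : IsTest (twistedDeriv σ k χ) :=
  ((h.mul_cexp σ).iteratedDeriv k).mul_cexp (-σ)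

lemma laplaceTest_twistedDeriv (h : IsTest χ) (σ : ℂ) (k : ℕ) (s : ℂ) :
    laplaceTest (twistedDeriv σ k χ) s = (-(s - σ)) ^ k * laplaceTest χ s := by
  have h1 := laplaceTest_mul_cexp (iteratedDeriv k fun t : ℝ ↦ χ t * Complex.exp (σ * t)) (-σ) s
  rw [laplaceTest_iteratedDeriv (h.mul_cexp σ), laplaceTest_mul_cexp χ σ,
    neg_add_cancel_right] at h1
  rw [sub_eq_add_neg]
  exact h1

lemma integral_Ioi_exp_mul_iteratedDeriv (h : IsTest χ) (σ : ℂ) (k : ℕ) {c : ℝ} {ρ : ℂ}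
    (hρ : ρ.re < c) :
    (-1) ^ k * ∫ t in Set.Ioi (0 : ℝ), Complex.exp ((ρ - σ) * t) *
        iteratedDeriv k (fun t : ℝ ↦ χ t * Complex.exp (σ * t)) t =
      (2 * Real.pi : ℂ)⁻¹ *
        ∫ u : ℝ, (line c u - σ) ^ k / (line c u - ρ) * laplaceTest χ (line c u) := by
  have h1 := integral_Ioi_mul_cexp (h.twistedDeriv σ k) hρ
  have h2 : ∫ t in Set.Ioi (0 : ℝ), Complex.exp ((ρ - σ) * t) *
      iteratedDeriv k (fun t : ℝ ↦ χ t * Complex.exp (σ * t)) t =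
      ∫ t in Set.Ioi (0 : ℝ), twistedDeriv σ k χ t * Complex.exp (ρ * t) := by
    refine integral_congr_ae (ae_of_all _ fun t ↦ ?_)
    simp only [twistedDeriv]
    rw [mul_assoc, ← Complex.exp_add, mul_comm]
    congr 2
    ring
  rw [h2, h1, mul_left_comm, ← integral_const_mul]
  congr 1
  refine integral_congr_ae (ae_of_all _ fun u ↦ ?_)
  simp only
  rw [laplaceTest_twistedDeriv h, neg_pow (line c u - σ)]
  have h3 : ((-1 : ℂ) ^ k) * (-1) ^ k = 1 := by rw [← mul_pow]; simp
  linear_combination ((line c u - σ) ^ k / (line c u - ρ) * laplaceTest χ (line c u)) * h3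

lemma integral_Ioi_iteratedDeriv_eq (h : IsTest χ) (σ : ℂ) (k : ℕ) (c : ℝ) :
    (-1) ^ (k + 1) * ∫ t in Set.Ioi (0 : ℝ),
        iteratedDeriv (k + 1) (fun t : ℝ ↦ χ t * Complex.exp (σ * t)) t =
      (2 * Real.pi : ℂ)⁻¹ * ∫ u : ℝ, (line c u - σ) ^ k * laplaceTest χ (line c u) := by
  rw [integral_Ioi_iteratedDeriv_succ (h.mul_cexp σ)]
  have h1 := laplaceTest_inversion (h.twistedDeriv σ k) c 0
  have h2 : twistedDeriv σ k χ 0 =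
      iteratedDeriv k (fun t : ℝ ↦ χ t * Complex.exp (σ * t)) 0 := by
    simp [twistedDeriv]
  rw [← h2, h1, pow_succ, mul_neg_one, neg_mul_neg, mul_left_comm, ← integral_const_mul]
  congr 1
  refine integral_congr_ae (ae_of_all _ fun u ↦ ?_)
  simp only [Complex.ofReal_zero, mul_zero, Complex.exp_zero, mul_one]
  rw [laplaceTest_twistedDeriv h, neg_pow (line c u - σ)]
  have h3 : ((-1 : ℂ) ^ k) * (-1) ^ k = 1 := by rw [← mul_pow]; simp
  linear_combination ((line c u - σ) ^ k * laplaceTest χ (line c u)) * h3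

end

section

variable {f : ℂ → ℂ} {χ : ℝ → ℂ}

/-! ### The Newton-Cramer distribution and the partial fraction expansion -/

lemma integral_polynomial_mul_laplaceTest (h : IsTest χ) (c : ℝ) (P : Polynomial ℂ) {g : ℕ}
    (hP : P.degree < g) :
    Integrable (fun u : ℝ ↦ P.eval (line c u) * laplaceTest χ (line c u)) ∧
    ∑ j ∈ Finset.range g, P.coeff j * ((-1) ^ j * iteratedDeriv j χ 0) =
      (2 * Real.pi : ℂ)⁻¹ * ∫ u : ℝ, P.eval (line c u) * laplaceTest χ (line c u) := by
  have hint : ∀ j, Integrable fun u : ℝ ↦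
      P.coeff j * ((line c u) ^ j * laplaceTest χ (line c u)) := fun j ↦
    (integrable_mul_laplaceTest h c j 1 ((continuous_line c).pow j) fun u ↦ by
      rw [Pi.pow_apply, norm_pow, one_mul]
      gcongr
      linarith).const_mul _
  have heq : ∀ u : ℝ, P.eval (line c u) * laplaceTest χ (line c u) =
      ∑ j ∈ Finset.range g, P.coeff j * ((line c u) ^ j * laplaceTest χ (line c u)) := by
    intro u
    have hsum : P.eval (line c u) = ∑ j ∈ Finset.range g, P.coeff j * (line c u) ^ j := by
      rcases eq_or_ne P 0 with rfl | h0
      · simp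
      · exact Polynomial.eval_eq_sum_range' ((Polynomial.natDegree_lt_iff_degree_lt h0).2 hP) _
    rw [hsum, Finset.sum_mul]
    exact Finset.sum_congr rfl fun j _ ↦ by ring
  simp_rw [heq]
  refine ⟨integrable_finsetSum _ fun j _ ↦ hint j, ?_⟩
  rw [integral_finsetSum _ fun j _ ↦ hint j, Finset.mul_sum]
  refine Finset.sum_congr rfl fun j _ ↦ ?_
  rw [iteratedDeriv_zero_eq_integral h c, integral_const_mul]
  ring

/-- The contribution of the origin `σ` to both sides. -/
lemma integral_Ioi_pow_mul_iteratedDeriv_eq (h : IsTest χ) (k : ℕ) {c : ℝ} {σ : ℂ} (n : ℂ)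
    (hn : n ≠ 0 → σ.re < c) :
    Integrable (fun u : ℝ ↦ n / (line c u - σ) * laplaceTest χ (line c u)) ∧
    (-1) ^ k * ∫ t in Set.Ioi (0 : ℝ), n * ((t : ℂ) ^ k / k.factorial) *
        iteratedDeriv k (fun t : ℝ ↦ χ t * Complex.exp (σ * t)) t =
      (2 * Real.pi : ℂ)⁻¹ * ∫ u : ℝ, n / (line c u - σ) * laplaceTest χ (line c u) := by
  rcases eq_or_ne n 0 with rfl | h0
  · simp
  have hσ := hn h0
  have hne : ∀ u, line c u - σ ≠ 0 := fun u h ↦ by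
    have := congr_arg Complex.re h
    rw [Complex.sub_re, line_re, Complex.zero_re] at this
    linarith
  have hdist : ∀ u, c - σ.re ≤ ‖line c u - σ‖ := fun u ↦ by
    have := (le_abs_self _).trans (Complex.abs_re_le_norm (line c u - σ))
    rwa [Complex.sub_re, line_re] at this
  constructor
  · refine integrable_mul_laplaceTest h c 0 (‖n‖ / (c - σ.re))
      (continuous_const.div ((continuous_line c).sub continuous_const) hne) fun u ↦ ?_
    rw [norm_div, pow_zero, mul_one]
    have : 0 < c - σ.re := by linarith
    gcongr
    exact hdist u
  · have h1 := integral_Ioi_pow_mul_iteratedDeriv (h.mul_cexp σ) k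
    rw [integral_Ioi_mul_cexp h hσ] at h1
    simp_rw [mul_assoc n]
    rw [integral_const_mul, mul_left_comm, h1, mul_left_comm, ← integral_const_mul]
    congr 1
    refine integral_congr_ae (ae_of_all _ fun u ↦ ?_)
    simp only
    ring

/-- The contribution of a point `ρ ≠ σ` of the divisor to both sides: subtracting the value at
`t = 0` of the exponential turns `(s - σ)^d / (s - ρ)` into the difference
`(s - σ)^d / (s - ρ) - (s - σ)^(d - 1)`, which is a multiple of the term of the partial fraction
series. -/
lemma integral_Ioi_kernelTerm_sub (h : IsTest χ) (hd : 1 ≤ convergenceExponent f) {c σ₂ : ℝ}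
    (hc : σ₂ < c) (hσ₂ : ∀ ρ : ℂ, mult f ρ ≠ 0 → ρ.re ≤ σ₂) (σ : ℂ) (ρ : {ρ : ℂ // ρ ≠ σ}) :
    (-1) ^ convergenceExponent f * ∫ t in Set.Ioi (0 : ℝ),
        (kernelTerm f (convergenceExponent f) σ t ρ - kernelTerm f (convergenceExponent f) σ 0 ρ) *
          iteratedDeriv (convergenceExponent f) (fun t : ℝ ↦ χ t * Complex.exp (σ * t)) t =
      (2 * Real.pi : ℂ)⁻¹ *
        ∫ u : ℝ, fractionTerm f σ (line c u) ρ * laplaceTest χ (line c u) := by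
  by_cases hρ : mult f ρ = 0
  · simp [kernelTerm, fractionTerm, hρ]
  have hre : (ρ : ℂ).re < c := (hσ₂ ρ hρ).trans_lt hc
  obtain ⟨m, hm⟩ : ∃ m, convergenceExponent f = m + 1 :=
    ⟨_, (one_add_sub_convergenceExponent hd).symm⟩
  have hne : ∀ u, line c u - ρ ≠ 0 := fun u h ↦ by
    have := congr_arg Complex.re h
    rw [Complex.sub_re, line_re, Complex.zero_re] at this
    linarith
  have hdist : ∀ u, c - (ρ : ℂ).re ≤ ‖line c u - ρ‖ := fun u ↦ by
    have := (le_abs_self _).trans (Complex.abs_re_le_norm (line c u - ρ))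
    rwa [Complex.sub_re, line_re] at this
  have hρσ := sub_ne_zero_of_index ρ
  rw [hm]
  have hψ := (h.mul_cexp σ).iteratedDeriv (m + 1)
  set ψ := iteratedDeriv (m + 1) (fun t : ℝ ↦ χ t * Complex.exp (σ * t))
  have hi1 : IntegrableOn (fun t : ℝ ↦ Complex.exp (((ρ : ℂ) - σ) * t) * ψ t) (Set.Ioi 0) :=
    ((hψ.integrable_mul_cexp _).congr (ae_of_all _ fun t ↦ mul_comm _ _)).integrableOn
  have hgrow : ∀ (k : ℕ) (u : ℝ), ‖line c u - σ‖ ^ k ≤ (1 + ‖σ‖) ^ k * (1 + ‖line c u‖) ^ k := by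
    intro k u
    rw [← mul_pow]
    gcongr
    have := norm_sub_le (line c u) σ
    nlinarith [norm_nonneg (line c u), norm_nonneg σ]
  have hi2 : Integrable fun u : ℝ ↦
      (line c u - σ) ^ (m + 1) / (line c u - ρ) * laplaceTest χ (line c u) := by
    refine integrable_mul_laplaceTest h c (m + 1) ((1 + ‖σ‖) ^ (m + 1) / (c - (ρ : ℂ).re))
      ((((continuous_line c).sub continuous_const).pow _).div
        ((continuous_line c).sub continuous_const) hne) fun u ↦ ?_
    have : 0 < c - (ρ : ℂ).re := by linarith
    rw [norm_div, norm_pow, div_mul_eq_mul_div]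
    gcongr
    · exact hgrow _ u
    · exact hdist u
  have hi3 : Integrable fun u : ℝ ↦ (line c u - σ) ^ m * laplaceTest χ (line c u) := by
    refine integrable_mul_laplaceTest h c m ((1 + ‖σ‖) ^ m)
      (((continuous_line c).sub continuous_const).pow _) fun u ↦ ?_
    rw [norm_pow]
    exact hgrow _ u
  have hA := integral_Ioi_exp_mul_iteratedDeriv h σ (m + 1) hre
  have hB := integral_Ioi_iteratedDeriv_eq h σ m c
  have hL : ∀ t : ℝ, (kernelTerm f (m + 1) σ t ρ - kernelTerm f (m + 1) σ 0 ρ) * ψ t =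
      (mult f ρ : ℂ) / ((ρ : ℂ) - σ) ^ (m + 1) *
        (Complex.exp (((ρ : ℂ) - σ) * t) * ψ t - ψ t) := by
    intro t
    simp only [kernelTerm, Complex.ofReal_zero, mul_zero, Complex.exp_zero]
    ring
  have hR : ∀ u : ℝ, fractionTerm f σ (line c u) ρ * laplaceTest χ (line c u) =
      (mult f ρ : ℂ) / ((ρ : ℂ) - σ) ^ (m + 1) *
        ((line c u - σ) ^ (m + 1) / (line c u - ρ) * laplaceTest χ (line c u) -
          (line c u - σ) ^ m * laplaceTest χ (line c u)) := by
    intro u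
    have h1 := hne u
    rw [fractionTerm, hm, Nat.add_sub_cancel]
    field_simp
    ring
  simp_rw [hL, hR]
  rw [integral_const_mul, integral_const_mul, integral_sub hi1 hψ.integrable.integrableOn,
    integral_sub hi2 hi3]
  linear_combination (mult f ρ : ℂ) / ((ρ : ℂ) - σ) ^ (m + 1) * (hA - hB)

lemma tsum_fractionTerm_mul_laplaceTest (h : IsTest χ) (hd : 1 ≤ convergenceExponent f) {c σ₂ : ℝ}
    (hc : σ₂ < c) (hσ₂ : ∀ ρ : ℂ, mult f ρ ≠ 0 → ρ.re ≤ σ₂) (σ : ℂ) :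
    Integrable (fun u : ℝ ↦ (∑' ρ, fractionTerm f σ (line c u) ρ) * laplaceTest χ (line c u)) ∧
    ∑' ρ, ∫ u : ℝ, fractionTerm f σ (line c u) ρ * laplaceTest χ (line c u) =
      ∫ u : ℝ, (∑' ρ, fractionTerm f σ (line c u) ρ) * laplaceTest χ (line c u) := by
  have hδ : 0 < c - σ₂ := by linarith
  set m := convergenceExponent f - 1
  have hdist : ∀ ρ : ℂ, mult f ρ ≠ 0 → ∀ u, c - σ₂ ≤ ‖line c u - ρ‖ := fun ρ hρ u ↦ by
    have h1 := (le_abs_self _).trans (Complex.abs_re_le_norm (line c u - ρ))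
    have h2 := hσ₂ ρ hρ
    rw [Complex.sub_re, line_re] at h1
    linarith
  have hG : Integrable fun u : ℝ ↦ ‖line c u - σ‖ ^ m * (1 + ‖line c u - σ‖ / (c - σ₂)) *
      ‖laplaceTest χ (line c u)‖ := by
    have hcont : Continuous fun u : ℝ ↦
        ((‖line c u - σ‖ ^ m * (1 + ‖line c u - σ‖ / (c - σ₂)) : ℝ) : ℂ) := by fun_prop
    refine (integrable_mul_laplaceTest h c (m + 1)
      ((1 + ‖σ‖) ^ m * (1 + (1 + ‖σ‖) / (c - σ₂))) hcont fun u ↦ ?_).norm.congr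
      (ae_of_all _ fun u ↦ ?_)
    · rw [Complex.norm_real, Real.norm_of_nonneg (by positivity)]
      have h1 : ‖line c u - σ‖ ≤ (1 + ‖σ‖) * (1 + ‖line c u‖) := by
        have := norm_sub_le (line c u) σ
        nlinarith [norm_nonneg (line c u), norm_nonneg σ]
      have h2 : 1 ≤ 1 + ‖line c u‖ := by linarith [norm_nonneg (line c u)]
      calc ‖line c u - σ‖ ^ m * (1 + ‖line c u - σ‖ / (c - σ₂))
          ≤ ((1 + ‖σ‖) * (1 + ‖line c u‖)) ^ m *
            ((1 + ‖line c u‖) + (1 + ‖σ‖) * (1 + ‖line c u‖) / (c - σ₂)) := by gcongr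
        _ = _ := by rw [mul_pow]; ring
    · simp only
      rw [norm_mul, Complex.norm_real, Real.norm_of_nonneg (by positivity)]
  have hmeas : ∀ ρ : {ρ : ℂ // ρ ≠ σ}, AEStronglyMeasurable
      (fun u : ℝ ↦ fractionTerm f σ (line c u) ρ * laplaceTest χ (line c u)) := by
    intro ρ
    refine AEStronglyMeasurable.mul (Measurable.aestronglyMeasurable ?_)
      (continuous_laplaceTest_line h c).aestronglyMeasurable
    unfold fractionTerm
    fun_prop
  have hmain := tsum_integral_of_norm_le hmeas (summable_mult_div hd σ) hG
    (ae_of_all _ fun u ρ ↦ by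
      rw [norm_mul, ← mul_assoc]
      gcongr
      exact norm_fractionTerm_le hδ ρ fun hρ ↦ hdist ρ hρ u)
  simpa only [tsum_mul_right] using hmain

/-- The Newton-Cramer distribution on a test function, as an integral of the divisor part of the
partial fraction expansion of `f'/f` along a line to the right of the divisor. -/
theorem newtonCramer_apply (hd : 1 ≤ convergenceExponent f) {c σ₂ : ℝ} (hc : σ₂ < c)
    (hσ₂ : ∀ ρ : ℂ, mult f ρ ≠ 0 → ρ.re ≤ σ₂) (σ : ℂ)
    (φ : 𝓓((⊤ : TopologicalSpace.Opens ℝ), ℝ)) :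
    newtonCramer f σ φ = (2 * Real.pi : ℂ)⁻¹ *
      ((∫ u : ℝ, (mult f σ : ℂ) / (line c u - σ) * laplaceTest (complexTest φ) (line c u)) +
        ∫ u : ℝ, (∑' ρ, fractionTerm f σ (line c u) ρ) *
          laplaceTest (complexTest φ) (line c u)) := by
  have hχ := isTest_complexTest φ
  set χ := complexTest φ
  set d := convergenceExponent f
  have hcont := continuous_kernel_max hd hσ₂ σ
  have hloc : LocallyIntegrable
      (Set.indicator (Set.Ici (0 : ℝ)) fun t ↦ kernel f d σ t - kernel f d σ 0) := by
    rw [indicator_kernel_sub]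
    exact (hcont.sub continuous_const).locallyIntegrable
  rw [newtonCramer, expMul_distDeriv_iterate_ofFun_apply hloc]
  have hψ := (hχ.mul_cexp σ).iteratedDeriv d
  set ψ := iteratedDeriv d (fun t : ℝ ↦ χ t * Complex.exp (σ * t)) with hψdef
  have hG : IntegrableOn (fun t : ℝ ↦ (Real.exp ((σ₂ - σ.re) * t) + 1) * ‖ψ t‖) (Set.Ioi 0) :=
    ((by fun_prop : Continuous fun t : ℝ ↦ Real.exp ((σ₂ - σ.re) * t) + 1).mul
      hψ.1.continuous.norm).integrable_of_hasCompactSupport hψ.2.norm.mul_left |>.integrableOn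
  have hb : ∀ᵐ t ∂(volume.restrict (Set.Ioi (0 : ℝ))), ∀ ρ : {ρ : ℂ // ρ ≠ σ},
      ‖(kernelTerm f d σ t ρ - kernelTerm f d σ 0 ρ) * ψ t‖ ≤
        |(mult f ρ : ℝ)| / ‖(ρ : ℂ) - σ‖ ^ d *
          ((Real.exp ((σ₂ - σ.re) * t) + 1) * ‖ψ t‖) := by
    filter_upwards [ae_restrict_mem measurableSet_Ioi] with t ht ρ
    rw [norm_mul, ← mul_assoc]
    gcongr
    refine (norm_sub_le _ _).trans ?_
    have h1 := norm_kernelTerm_le hσ₂ d σ (le_of_lt ht) ρ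
    have h2 := norm_kernelTerm_le hσ₂ d σ le_rfl ρ
    rw [mul_zero, Real.exp_zero] at h2
    rw [mul_add]
    exact add_le_add h1 h2
  have hsum := tsum_integral_of_norm_le (fun ρ : {ρ : ℂ // ρ ≠ σ} ↦ by
      refine Continuous.aestronglyMeasurable ?_
      have := hψ.1.continuous
      unfold kernelTerm
      fun_prop) (summable_mult_div' hd σ) hG hb
  have hpow : IntegrableOn (fun t : ℝ ↦ (mult f σ : ℂ) * ((t : ℂ) ^ d / d.factorial) * ψ t)
      (Set.Ioi 0) :=
    (((by fun_prop : Continuous fun t : ℝ ↦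
      (mult f σ : ℂ) * ((t : ℂ) ^ d / d.factorial)).mul
        hψ.1.continuous).integrable_of_hasCompactSupport hψ.2.mul_left).integrableOn
  have hL : ∫ t : ℝ, Set.indicator (Set.Ici (0 : ℝ))
      (fun t ↦ kernel f d σ t - kernel f d σ 0) t * ψ t =
      (∫ t in Set.Ioi (0 : ℝ), (mult f σ : ℂ) * ((t : ℂ) ^ d / d.factorial) * ψ t) +
        ∑' ρ, ∫ t in Set.Ioi (0 : ℝ),
          (kernelTerm f d σ t ρ - kernelTerm f d σ 0 ρ) * ψ t := by
    rw [integral_congr_ae (ae_of_all _ fun t ↦ (Set.indicator_mul_left (Set.Ici (0 : ℝ))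
      (fun t ↦ kernel f d σ t - kernel f d σ 0) ψ (i := t)).symm),
      integral_indicator measurableSet_Ici, integral_Ici_eq_integral_Ioi, hsum.2,
      ← integral_add hpow hsum.1]
    refine setIntegral_congr_fun measurableSet_Ioi fun t ht ↦ ?_
    rw [kernel_sub_kernel_zero hd hσ₂ σ (le_of_lt ht), tsum_mul_right, add_mul]
  have h1 := (integral_Ioi_pow_mul_iteratedDeriv_eq hχ d (c := c) (σ := σ) (mult f σ : ℂ)
    fun hn ↦ (hσ₂ σ (by exact_mod_cast hn)).trans_lt hc).2
  rw [hL, mul_add, h1, mul_add, ← (tsum_fractionTerm_mul_laplaceTest hχ hd hc hσ₂ σ).2,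
    ← tsum_mul_left, ← tsum_mul_left]
  congr 1
  exact tsum_congr fun ρ ↦ integral_Ioi_kernelTerm_sub hχ hd hc hσ₂ σ ρ

/-- The distributional identity: on a test function both sides are integrals along `Re s = c`,
and the integrands agree by the partial fraction expansion of `f'/f`. -/
theorem newtonCramer_eq (hf : Meromorphic f) (hd : 1 ≤ convergenceExponent f) {σ : ℂ}
    {Q : Polynomial ℂ} (hQ : IsHadamardPolynomial f σ Q) {g : ℕ}
    (hg : (-Polynomial.derivative Q).degree < g) {c : ℝ} {m₀ : ℕ}
    (h : LaplaceAdmissible (logDerivative f) c m₀) :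
    newtonCramer f σ =
      (∑ j ∈ Finset.range g, (-Polynomial.derivative Q).coeff j • distDeriv^[j] dirac) +
        inverseLaplace (logDerivative f) c m₀ := by
  -- Holomorphy of `f'/f` for `Re s > σ₂` keeps the divisor to the left of the line `Re s = c`.
  obtain ⟨σ₂, hc, hσ₂⟩ : ∃ σ₂ : ℝ, σ₂ < c ∧ ∀ ρ : ℂ, mult f ρ ≠ 0 → ρ.re ≤ σ₂ := by
    obtain ⟨σ₂, C, -, h1, h2, -⟩ := h
    refine ⟨σ₂, h1, fun ρ hρ ↦ ?_⟩
    by_contra! hlt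
    refine hρ (mult_eq_zero_of_continuousAt_logDerivative hf hd ?_)
    exact h2.continuousOn.continuousAt
      ((isOpen_lt continuous_const Complex.continuous_re).mem_nhds hlt)
  ext φ
  have hχ := isTest_complexTest φ
  set P := -Polynomial.derivative Q with hPdef
  have h1 := integral_polynomial_mul_laplaceTest hχ c P hg
  have h2 := (integral_Ioi_pow_mul_iteratedDeriv_eq hχ 0 (c := c) (σ := σ) (mult f σ : ℂ)
    fun hn ↦ (hσ₂ σ (by exact_mod_cast hn)).trans_lt hc).1
  have h3 := (tsum_fractionTerm_mul_laplaceTest hχ hd hc hσ₂ σ).1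
  have hR : ((∑ j ∈ Finset.range g, P.coeff j • distDeriv^[j] dirac) +
      inverseLaplace (logDerivative f) c m₀) φ =
      (∑ j ∈ Finset.range g, P.coeff j * ((-1) ^ j * iteratedDeriv j (complexTest φ) 0)) +
        inverseLaplace (logDerivative f) c m₀ φ := by
    simp_rw [← distDeriv_iterate_dirac_apply]
    simp
  have hlog : ∀ u : ℝ, logDerivative f (line c u) * laplaceTest (complexTest φ) (line c u) =
      (mult f σ : ℂ) / (line c u - σ) * laplaceTest (complexTest φ) (line c u) +
      (∑' ρ, fractionTerm f σ (line c u) ρ) * laplaceTest (complexTest φ) (line c u) -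
      P.eval (line c u) * laplaceTest (complexTest φ) (line c u) := by
    intro u
    rw [(analyticAt_logDerivative hf hd hQ
      (mult_eq_zero_of_lt hσ₂ (s := line c u) (by rwa [line_re]))).2, hPdef, Polynomial.eval_neg]
    ring
  rw [hR, h1.2, h.inverseLaplace_apply, newtonCramer_apply hd hc hσ₂]
  simp_rw [hlog]
  have h23 : Integrable fun u : ℝ ↦
      (mult f σ : ℂ) / (line c u - σ) * laplaceTest (complexTest φ) (line c u) +
        (∑' ρ, fractionTerm f σ (line c u) ρ) * laplaceTest (complexTest φ) (line c u) := h2.add h3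
  rw [integral_sub h23 h1.1, integral_add h2 h3]
  ring

end

end PoissonNewton

theorem mainTheorem1 (f : ℂ → ℂ) (hf : PoissonNewton.IsMeromorphicOfFiniteOrder f)
    (hd : 1 ≤ PoissonNewton.convergenceExponent f) (hleft : PoissonNewton.HasLeftDivisor f)
    (σ : ℂ) :
    (∀ t : ℝ, 0 ≤ t →
      Summable (PoissonNewton.kernelTerm f (PoissonNewton.convergenceExponent f) σ t)) ∧
    (∃ Q₀ : Polynomial ℂ, PoissonNewton.IsHadamardPolynomial f 0 Q₀) ∧
    (∃ Q : Polynomial ℂ, PoissonNewton.IsHadamardPolynomial f σ Q) ∧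
    (∃ (c : ℝ) (m₀ : ℕ), PoissonNewton.LaplaceAdmissible (PoissonNewton.logDerivative f) c m₀) ∧
    ∀ Q₀ Q : Polynomial ℂ, PoissonNewton.IsHadamardPolynomial f 0 Q₀ →
      PoissonNewton.IsHadamardPolynomial f σ Q →
      ∀ (g : ℕ) (P : Polynomial ℂ),
        g = max Q₀.natDegree (PoissonNewton.convergenceExponent f - 1) →
        P = -Polynomial.derivative Q →
        P.degree < g ∧
        ∀ (c : ℝ) (m₀ : ℕ),
          PoissonNewton.LaplaceAdmissible (PoissonNewton.logDerivative f) c m₀ →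
          PoissonNewton.newtonCramer f σ =
            (∑ j ∈ Finset.range g, P.coeff j • PoissonNewton.distDeriv^[j] PoissonNewton.dirac) +
              PoissonNewton.inverseLaplace (PoissonNewton.logDerivative f) c m₀ := by
  obtain ⟨σ₁, hσ₁⟩ := hleft
  refine ⟨fun t ht ↦ PoissonNewton.summable_kernelTerm hd hσ₁ σ ht,
    PoissonNewton.exists_isHadamardPolynomial hf hd 0,
    PoissonNewton.exists_isHadamardPolynomial hf hd σ,
    PoissonNewton.exists_laplaceAdmissible hf hd ⟨σ₁, hσ₁⟩, ?_⟩
  rintro Q₀ Q hQ₀ hQ g P rfl rfl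
  have hdeg := PoissonNewton.degree_discrepancy_lt hf.1 hd ⟨σ₁, hσ₁⟩ hQ₀ hQ
  exact ⟨hdeg, fun c m₀ h ↦ PoissonNewton.newtonCramer_eq hf.1 hd hQ hdeg h⟩
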